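/- **Setting.** For $\lambda\ge\sigma>0$ let $\mathcal D(\lambda,\sigma)$ be the set of probability distributions $D$ on $\mathbb R$ with finite second moment, mean $\mu(D)\in[-\lambda,\lambda]$ and variance at most $\sigma^2$. In a sequential 1-bit protocol with $n$ samples, in each round $t=1,\dots,n$ the learner picks, depending on its internal randomness and on the earlier answers, a measurable set $Q_t\subseteq\mathbb R$ and receives only the bit $\mathbf 1\{X_t\in Q_t\}$, where $X_1,X_2,\dots$ are i.i.d. from $D$ and independent of the internal randomness; after $n$ rounds it forms its output. An estimator is $(\epsilon,\delta)$-PAC for a family if, for every $D$ in the family, $\Pr(|\hat\mu-\mu(D)|\le\epsilon)\ge 1-\delta$. Write $\operatorname{lg}x=\max\{1,\ln x\}$. **Estimator**, for parameters $\lambda\ge\sigma>0$, $\epsilon>0$, $0<\delta<1$. 1. *Localization.* Let $G=\{k\sigma: k\in\mathbb Z,\ |k|\le\lceil\lambda/\sigma\rceil+2\}$. A noisy binary search for the median is a sequential 1-bit protocol, depending on $\lambda,\sigma,\delta$ only, that asks only threshold queries "is $X\le\theta$?" with $\theta\in G$ and outputs $L,U\in G$ such that, for every $D\in\mathcal D(\lambda,\sigma)$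 with distribution function $F$, $[F(L),F(L+\sigma)]$ meets $(0.49,0.5)$ with probability at least $1-\delta/3$, and $[F(U-\sigma),F(U)]$ meets $(0.5,0.51)$ with probability at least $1-\delta/3$. Put $c=(L+U)/2$. 2. *Regions.* Let $m_0=0$, $m_i=2^i$ for $1\le i\le4$, and $m_i=2(m_{i-1}-3)$ for $i\ge5$. For $i\ge1$ let $R_i=[\sigma m_{i-1},\sigma m_i)$ and $R_{-i}=-R_i$. Let $a_i<b_i$ be the end points of $R_i$. Let $i_{\max}$ be the least $i\ge5$ with $2^{-i}\le 5\epsilon/(128\sigma)$. 3. *Refinement.* For $1\le|i|\le i_{\max}$ let $\epsilon_i=\epsilon/\big(4i_{\max}(|a_i|+|b_i|)\big)$, $\delta'=\delta/(12\,i_{\max})$, and $n_i=\big\lceil\frac{1}{2\epsilon_i^2}\ln\frac2{\delta'}\big\rceil$ if $|i|\le4$, $n_i=\big\lceil\big(\frac{8}{m_{|i|}^2\epsilon_i^2}+\frac{2}{3\epsilon_i}\big)\ln\frac2{\delta'}\big\rceil$ if $|i|\ge5$. With fresh samples and fresh independent $T\sim\mathrm{Unif}(a_i,b_i)$ for every query,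 let $\hat p_{a_i}$ be the fraction of positive answers to $n_i$ queries "is $X-c\in R_i$ and $X-c\le T$?", and $\hat p_{b_i}$ the fraction of positive answers to $n_i$ queries "is $X-c\in R_i$ and $X-c\ge T$?". The estimate is $\hat\mu=c+\sum_{1\le|i|\le i_{\max}}(a_i\hat p_{a_i}+b_i\hat p_{b_i})$. **Theorem 1.** There are absolute constants $C>0$ and $d\in\mathbb N$ such that for all $\lambda\ge\sigma>0$ and $0<\delta<1$ there is a noisy binary search for the median, as in step 1, that uses at most $C\big(\ln\frac\lambda\sigma+\operatorname{lg}\frac1\delta\big)$ samples and with which, for every $\epsilon>0$, the estimator above asks only interval queries (intervals may be unbounded and may or may not contain their end points) and is $(\epsilon,\delta)$-PAC for $\mathcal D(\lambda,\sigma)$. If moreover $\epsilon\le\sigma$, the number $n$ of samples it uses satisfies $$n\le C\Big(\frac{\sigma^2}{\epsilon^2}\,\operatorname{lg}^3\!\Big(\frac\sigma\epsilon\Big)\,\operatorname{lg}\!\Big(\frac{\operatorname{lg}(\sigma/\epsilon)}{\delta}\Big)+\ln\frac\lambda\sigma\Big)$$ and $$n\le C\Big(\frac{\sigma^2}{\epsilon^2}\,\operatorname{lg}\!\Big(\frac1\delta\Big)\operatorname{lg}^{d}\!\Big(\frac\sigma\epsilon\Big)+\ln\frac\lambda\sigma\Big).$$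 -/

import Mathlib

open MeasureTheory ProbabilityTheory

noncomputable section

/-- The distributions on the real line with finite second moment, mean in `[-lam, lam]` and
variance at most `sig ^ 2`. -/
def meanVarFamily (lam sig : ℝ) : Set (Measure ℝ) :=
  {D | IsProbabilityMeasure D ∧ MemLp (fun x : ℝ => x) 2 D ∧
    (∫ x, x ∂D) ∈ Set.Icc (-lam) lam ∧ variance (fun x : ℝ => x) D ≤ sig ^ 2}

/-- The answers `Y₁, Y₂, …` (oldest first) given by a memoryless agent to the adaptive query
strategy `q` on the successive samples `xs`. The 1-bit quantizer asked after the answers `h` is the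
indicator of the set `q h`; the answer to it depends only on the fresh sample. -/
def answers (q : List Bool → Set ℝ) (xs : List ℝ) : List Bool :=
  open Classical in xs.foldl (fun h x => h ++ [decide (x ∈ q h)]) []

/-- A sequential 1-bit communication protocol with a fixed number `n` of rounds (one sample and one
bit per round), a result in `α`, and internal randomness: a random `Seed` that is independent of
the samples. Past quantizers are determined by the seed and the past answers, so strategies and
output rules are functions of the seed and of the list of answers. -/
structure OneBitProtocol (α : Type) [MeasurableSpace α] where
  /-- number of samples -/
  n : ℕ
  Seed : Type
  seedSpace : MeasurableSpace Seed
  /-- law of the internal randomness -/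
  law : Measure Seed
  isProb : IsProbabilityMeasure law
  /-- the quantizer (as a set) asked after a given list of answers -/
  query : Seed → List Bool → Set ℝ
  /-- the result formed from all `n` answers -/
  output : Seed → List Bool → α
  measurableSet_query : ∀ h, MeasurableSet {p : Seed × ℝ | p.2 ∈ query p.1 h}
  measurable_output : ∀ h, Measurable fun ω => output ω h

attribute [instance] OneBitProtocol.seedSpace OneBitProtocol.isProb

namespace OneBitProtocol

variable {α : Type} [MeasurableSpace α]

/-- The result for a given seed and given samples. -/
def run (P : OneBitProtocol α) (ω : P.Seed) (X : Fin P.n → ℝ) : α :=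
  P.output ω (answers (P.query ω) (List.ofFn X))

/-- The joint law of the internal randomness and of `n` i.i.d. samples from `D`. -/
def joint (P : OneBitProtocol α) (D : Measure ℝ) : Measure (P.Seed × (Fin P.n → ℝ)) :=
  P.law.prod (Measure.pi fun _ => D)

/-- The probability that the result lies in `S` when the samples come from `D`. -/
def prob (P : OneBitProtocol α) (D : Measure ℝ) (S : Set α) : ℝ :=
  (P.joint D).real {p | P.run p.1 p.2 ∈ S}

/-- All queries ask whether the sample lies in an interval (possibly unbounded, with or without its
end points). -/
def OnlyIntervalQueries (P : OneBitProtocol α) : Prop :=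
  ∀ ω h, (P.query ω h).OrdConnected

/-- All queries are threshold queries "is `X ≤ θ`?" with `θ` in the set `G`. -/
def OnlyThresholdQueries (P : OneBitProtocol α) (G : Set ℝ) : Prop :=
  ∀ ω h, ∃ θ ∈ G, P.query ω h = Set.Iic θ

/-- An estimator is `(ε, δ)`-PAC for the family `𝒟` if its result is within `ε` of the mean with
probability at least `1 - δ`, for each distribution in the family. -/
def IsPAC (P : OneBitProtocol ℝ) (ε δ : ℝ) (𝒟 : Set (Measure ℝ)) : Prop :=
  ∀ D ∈ 𝒟, 1 - δ ≤ P.prob D {y | |y - ∫ x, x ∂D| ≤ ε}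

end OneBitProtocol

/-! ### Localization of the median -/

/-- The points with uniform spacing `sig` that cover `[-lam, lam]` with a margin of at least
`2 * sig` on either side. The margin makes sure that the grid straddles the median: outside it the
distribution function is at most `1/5`, respectively at least `4/5`. -/
def searchGrid (lam sig : ℝ) : Set ℝ :=
  {x | ∃ k : ℤ, |k| ≤ ⌈lam / sig⌉ + 2 ∧ x = k * sig}

/-- `P` performs noisy binary search for the median, with failure probability `η` at each end: by
threshold queries at grid points it finds grid points `L` and `U` such that, for each distribution
with distribution function `F` in the family, `[F(L), F(L + sig)]` meets `(0.49, 0.5)` with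
probability at least `1 - η`, and `[F(U - sig), F(U)]` meets `(0.5, 0.51)` with probability at
least `1 - η`. -/
structure IsNoisyMedianSearch (P : OneBitProtocol (ℝ × ℝ)) (lam sig η : ℝ) : Prop where
  queries : P.OnlyThresholdQueries (searchGrid lam sig)
  output_mem : ∀ ω h, P.output ω h ∈ searchGrid lam sig ×ˢ searchGrid lam sig
  lower : ∀ D ∈ meanVarFamily lam sig,
    1 - η ≤ P.prob D {z | (Set.Icc (cdf D z.1) (cdf D (z.1 + sig)) ∩
      Set.Ioo (0.49 : ℝ) 0.5).Nonempty}
  upper : ∀ D ∈ meanVarFamily lam sig,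
    1 - η ≤ P.prob D {z | (Set.Icc (cdf D (z.2 - sig)) (cdf D z.2) ∩
      Set.Ioo (0.5 : ℝ) 0.51).Nonempty}

/-! ### The regions -/

/-- The geometrically growing sequence `0, 2, 4, 8, 16, 26, 46, …`. -/
def mSeq : ℕ → ℝ
  | 0 => 0
  | i + 1 => if i + 1 ≤ 4 then 2 ^ (i + 1) else 2 * (mSeq i - 3)

theorem mSeq_lt_succ_aux (i : ℕ) : mSeq i < mSeq (i + 1) ∧ (4 ≤ i → 16 ≤ mSeq i) := by
  induction i with
  | zero => norm_num [mSeq]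
  | succ k ih =>
    rcases Nat.lt_or_ge k 3 with hk | hk
    · have : k = 0 ∨ k = 1 ∨ k = 2 := by omega
      rcases this with rfl | rfl | rfl <;> norm_num [mSeq]
    · rcases Nat.lt_or_ge k 4 with h4 | h4
      · have : k = 3 := by omega
        subst this
        norm_num [mSeq]
      · have h1 := ih.2 h4
        have h2 : mSeq (k + 1) = 2 * (mSeq k - 3) := by
          rw [mSeq, if_neg (by omega)]
        have h3 : mSeq (k + 1 + 1) = 2 * (mSeq (k + 1) - 3) := by
          rw [mSeq, if_neg (by omega)]
        refine ⟨?_, fun _ => ?_⟩ <;> linarith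

theorem mSeq_lt_succ (i : ℕ) : mSeq i < mSeq (i + 1) := (mSeq_lt_succ_aux i).1

/-- The left end point of the region with index `i = k + 1` (for `s = true`) or `i = -(k + 1)` (for
`s = false`). -/
def regionLo (sig : ℝ) (s : Bool) (k : ℕ) : ℝ :=
  if s then sig * mSeq k else -(sig * mSeq (k + 1))

/-- The right end point of the region with index `±(k + 1)`. -/
def regionHi (sig : ℝ) (s : Bool) (k : ℕ) : ℝ :=
  if s then sig * mSeq (k + 1) else -(sig * mSeq k)

/-- The region `[sig * m_{i-1}, sig * m_i)` with index `i = k + 1` for `s = true`, and its mirror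
image, with index `-i`, for `s = false`. -/
def region (sig : ℝ) (s : Bool) (k : ℕ) : Set ℝ :=
  if s then Set.Ico (regionLo sig s k) (regionHi sig s k)
  else Set.Ioc (regionLo sig s k) (regionHi sig s k)

/-- The randomized interval query of a region centred at `c`, with random end point `T`: is
`X - c` in the part of the region on the left (for `side = false`), respectively on the right (for
`side = true`), of `T`? For regions of positive index these parts are `[a, T]` and `[T, b)`. -/
def regionQuery (sig c : ℝ) (s : Bool) (k : ℕ) (side : Bool) (T : ℝ) : Set ℝ :=
  {x | x - c ∈ region sig s k ∧ if side then T ≤ x - c else x - c ≤ T}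

theorem regionLo_lt_regionHi {sig : ℝ} (hsig : 0 < sig) (s : Bool) (k : ℕ) :
    regionLo sig s k < regionHi sig s k := by
  have := mul_lt_mul_of_pos_left (mSeq_lt_succ k) hsig
  cases s <;> simp [regionLo, regionHi, this]

/-- The uniform distribution on the interval `(a, b)`. -/
def unifLaw (a b : ℝ) : Measure ℝ := ProbabilityTheory.cond volume (Set.Ioo a b)

theorem isProbabilityMeasure_unifLaw {a b : ℝ} (h : a < b) :
    IsProbabilityMeasure (unifLaw a b) := by
  refine ProbabilityTheory.cond_isProbabilityMeasure_of_finite ?_ ?_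
  · simp [Real.volume_Ioo, h]
  · simp [Real.volume_Ioo]

/-! ### Numbers of regions and of samples -/

/-- The largest absolute value of the index of a region that is taken into account: the least
`i ≥ 5` with `2 ^ (-i) ≤ 5 ε / (128 sig)`. -/
def iMax (sig ε : ℝ) : ℕ := sInf {i : ℕ | 5 ≤ i ∧ ((1 : ℝ) / 2) ^ i ≤ 5 * ε / (128 * sig)}

/-- The target accuracy for the two probabilities of a region with index `±(k + 1)`: the
`2 * iMax` regions share the error budget `ε / 2`. -/
def epsRegion (sig ε : ℝ) (k : ℕ) : ℝ :=
  ε / (4 * iMax sig ε * (sig * mSeq k + sig * mSeq (k + 1)))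

/-- The failure probability for each of the `4 * iMax` estimated probabilities: they share the
budget `δ / 3`. -/
def deltaRegion (sig ε δ : ℝ) : ℝ := δ / (12 * iMax sig ε)

/-- The number of samples for each of the two probabilities of a region with index `±(k + 1)`. -/
def nRegion (sig ε δ : ℝ) (k : ℕ) : ℕ :=
  if k + 1 ≤ 4 then
    ⌈1 / (2 * epsRegion sig ε k ^ 2) * Real.log (2 / deltaRegion sig ε δ)⌉₊
  else
    ⌈(8 / mSeq (k + 1) ^ 2 * (1 / epsRegion sig ε k ^ 2) + 2 / 3 * (1 / epsRegion sig ε k)) *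
      Real.log (2 / deltaRegion sig ε δ)⌉₊

/-- The refinement queries: sign `s` and position `k` of a region (its index is `±(k + 1)`), a
`side` of the random end point, and the number of the repetition. -/
abbrev RefineIdx (sig ε δ : ℝ) : Type :=
  (_ : Bool) × (k : Fin (iMax sig ε)) × (_ : Bool) × Fin (nRegion sig ε δ k)

/-- An enumeration of the refinement queries. They do not depend on each other's answers, so any
order will do. -/
def refineEquiv (sig ε δ : ℝ) : RefineIdx sig ε δ ≃ Fin (Fintype.card (RefineIdx sig ε δ)) :=
  Fintype.equivFin _

/-! ### The estimator -/

section Estimator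

variable (loc : OneBitProtocol (ℝ × ℝ)) (sig ε δ : ℝ)

/-- The mid-point of the localized interval `[L - sig, U + sig]`, from the first answers. -/
def centre (ω : loc.Seed) (h : List Bool) : ℝ :=
  ((loc.output ω (h.take loc.n)).1 + (loc.output ω (h.take loc.n)).2) / 2

/-- Localization queries first, then the refinement queries. -/
def estQuery (ω : loc.Seed × (RefineIdx sig ε δ → ℝ)) (h : List Bool) : Set ℝ :=
  if h.length < loc.n then loc.query ω.1 h
  else if hr : h.length - loc.n < Fintype.card (RefineIdx sig ε δ) then
    let j := (refineEquiv sig ε δ).symm ⟨h.length - loc.n, hr⟩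
    regionQuery sig (centre loc ω.1 h) j.1 j.2.1 j.2.2.1 (ω.2 j)
  else Set.univ

/-- The fraction of positive answers to the refinement queries of a region on a side. -/
def empFreq (h : List Bool) (s : Bool) (k : Fin (iMax sig ε)) (side : Bool) : ℝ :=
  (∑ r : Fin (nRegion sig ε δ k),
    if h.getD (loc.n + (refineEquiv sig ε δ ⟨s, k, side, r⟩ : ℕ)) false then (1 : ℝ) else 0) /
  nRegion sig ε δ k

/-- The centre plus the estimated contributions `a * p̂_a + b * p̂_b` of all regions considered. -/
def estOutput (ω : loc.Seed × (RefineIdx sig ε δ → ℝ)) (h : List Bool) : ℝ :=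
  centre loc ω.1 h + ∑ s : Bool, ∑ k : Fin (iMax sig ε),
    (regionLo sig s k * empFreq loc sig ε δ h s k false +
      regionHi sig s k * empFreq loc sig ε δ h s k true)

theorem measurable_centre (h : List Bool) : Measurable fun ω : loc.Seed => centre loc ω h := by
  have := loc.measurable_output (h.take loc.n)
  unfold centre
  fun_prop

theorem measurableSet_region (s : Bool) (k : ℕ) : MeasurableSet (region sig s k) := by
  cases s <;> simp [region]

/-- The mean estimator: it localizes the median by the procedure `loc`, centres the real line at the
mid-point of the localized interval, and estimates the contribution of each of the `2 * iMax`
central regions from randomized interval queries. -/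
def meanEstimator (hsig : 0 < sig) : OneBitProtocol ℝ where
  n := loc.n + Fintype.card (RefineIdx sig ε δ)
  Seed := loc.Seed × (RefineIdx sig ε δ → ℝ)
  seedSpace := inferInstance
  law := loc.law.prod (Measure.pi fun j : RefineIdx sig ε δ =>
    unifLaw (regionLo sig j.1 j.2.1) (regionHi sig j.1 j.2.1))
  isProb := by
    have : ∀ j : RefineIdx sig ε δ, IsProbabilityMeasure
        (unifLaw (regionLo sig j.1 j.2.1) (regionHi sig j.1 j.2.1)) := fun j =>
      isProbabilityMeasure_unifLaw (regionLo_lt_regionHi hsig _ _)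
    infer_instance
  query := estQuery loc sig ε δ
  output := estOutput loc sig ε δ
  measurableSet_query h := by
    unfold estQuery
    split_ifs with h1 h2
    · exact (((measurable_fst.comp measurable_fst).prodMk measurable_snd) :
        Measurable fun p : (loc.Seed × (RefineIdx sig ε δ → ℝ)) × ℝ => (p.1.1, p.2))
        (loc.measurableSet_query h)
    · have hc : Measurable fun p : (loc.Seed × (RefineIdx sig ε δ → ℝ)) × ℝ =>
          p.2 - centre loc p.1.1 h :=
        measurable_snd.sub ((measurable_centre loc h).comp (measurable_fst.comp measurable_fst))
      generalize (refineEquiv sig ε δ).symm ⟨h.length - loc.n, h2⟩ = j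
      have hT : Measurable fun p : (loc.Seed × (RefineIdx sig ε δ → ℝ)) × ℝ => p.1.2 j :=
        (measurable_pi_apply j).comp (measurable_snd.comp measurable_fst)
      obtain ⟨s, k, side, r⟩ := j
      refine MeasurableSet.inter (hc (measurableSet_region sig _ _)) ?_
      cases side
      · exact measurableSet_le hc hT
      · exact measurableSet_le hT hc
    · exact MeasurableSet.univ
  measurable_output h := by
    have := (measurable_centre loc h).comp
      (measurable_fst : Measurable (Prod.fst : loc.Seed × (RefineIdx sig ε δ → ℝ) → loc.Seed))
    unfold estOutput
    exact this.add_const _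

end Estimator

/-- The logarithm in a rate, bounded away from zero. -/
def rlog (x : ℝ) : ℝ := max 1 (Real.log x)

end

/-!
*Localization.* The median is within `O(sig)` of the mean by Chebyshev's inequality, so it suffices
to find a grid point near the median. `medianSearch` does this by multiplicative weights: each gap
`[j, j + 1]` of the grid carries a weight, each round queries both end points of the weighted median
gap, and each answer `b` at a point multiplies the weights on the right of that point by `tilt τ b`,
which has mean one if the response probability is the level `τ` that is looked for. Let `t` be the
gap at which the distribution function crosses `τ`. The reciprocal of the normalized weight of `t`
is at least one. On average it shrinks by a constant factor in each round whose median gap is bad,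
that is, not in `crossingGaps`: the distribution function at one of its end points is then clearly
on the wrong side of `τ`, and half of the weight is on the wrong side of that end point. In the
other rounds it grows by a much smaller factor
(`sum_mul_meanTilt_le_of_bad`, `sum_mul_meanTilt_le`). Hence `potential` is a supermartingale, and
except with probability `N * exp (-c * T)` fewer than half of `T` rounds are bad. The gaps that are
not bad form an interval, so the median of the gaps inspected is one of them
(`expect_searchResult_notMem_le`). Since the potential starts at the number `N` of gaps, the bound
`O(log N + log (1 / δ))` on the number of rounds has the two logarithms added and not multiplied.

*Refinement.* A point `z` of a region `[a, b]` is the mean of `b` with probability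
`P(T ≤ z) = (z - a) / (b - a)` and `a` with probability `P(z ≤ T)`. So the two query probabilities
of a region determine its contribution to the mean exactly (`regionLo_mul_add_regionHi_mul`), and
what lies outside the regions contributes at most `ε / 2` (`abs_sum_queryProb_sub_mean_le`). Given
the localization, the refinement bits are independent; Hoeffding's inequality near the centre and
Bernstein's inequality far away, where the regions have small probability by Chebyshev's inequality,
bound the deviations of the frequencies. `measurePreserving_assemble` provides the independence: it
describes seed and samples of the estimator by those of the localization and by an independent
family of pairs of a random end point and a sample.

*Numbers of samples.* `iMax` is `O(log (sig / ε))`, and each region needs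
`O(iMax ^ 2 * (sig / ε) ^ 2)` samples up to a logarithm: the far regions are long, but Bernstein's
inequality gains the square of their length (`nRegion_le`).
-/

/-! ### Adaptive sequences of answers -/

/-- The expectation of `f` of the answer history after `n` further questions, starting from the
history `h`, when the question asked after the history `g` is answered positively with probability
`r g`. -/
noncomputable def expect (r : List Bool → ℝ) : ℕ → (List Bool → ℝ) → List Bool → ℝ
  | 0, f, h => f h
  | n + 1, f, h =>
    r h * expect r n f (h ++ [true]) + (1 - r h) * expect r n f (h ++ [false])

section Expect

variable {r : List Bool → ℝ}

theorem expect_mono (hr : ∀ h, r h ∈ Set.Icc (0 : ℝ) 1) {f g : List Bool → ℝ} (n : ℕ)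
    (h : List Bool) (hfg : ∀ l : List Bool, l.length = n → f (h ++ l) ≤ g (h ++ l)) :
    expect r n f h ≤ expect r n g h := by
  induction n generalizing h with
  | zero => simpa [expect] using hfg [] rfl
  | succ n ih =>
    have key : ∀ b, expect r n f (h ++ [b]) ≤ expect r n g (h ++ [b]) := fun b =>
      ih _ fun l hl => by simpa using hfg (b :: l) (by simp [hl])
    obtain ⟨h0, h1⟩ := hr h
    exact add_le_add (mul_le_mul_of_nonneg_left (key true) h0)
      (mul_le_mul_of_nonneg_left (key false) (by linarith))

theorem expect_const (c : ℝ) (n : ℕ) (h : List Bool) : expect r n (fun _ => c) h = c := by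
  induction n generalizing h with
  | zero => rfl
  | succ n ih => simp only [expect, ih]; ring

theorem expect_const_mul (c : ℝ) (f : List Bool → ℝ) (n : ℕ) (h : List Bool) :
    expect r n (fun l => c * f l) h = c * expect r n f h := by
  induction n generalizing h with
  | zero => rfl
  | succ n ih => simp only [expect, ih]; ring

theorem expect_one_sub (f : List Bool → ℝ) (n : ℕ) (h : List Bool) :
    expect r n (fun l => 1 - f l) h = 1 - expect r n f h := by
  induction n generalizing h with
  | zero => rfl
  | succ n ih => simp only [expect, ih]; ring

theorem expect_add (m n : ℕ) (f : List Bool → ℝ) (h : List Bool) :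
    expect r (m + n) f h = expect r m (expect r n f) h := by
  induction m generalizing h with
  | zero => simp [expect]
  | succ m ih => rw [Nat.succ_add]; simp only [expect, ih]

/-- An experiment that starts from the history `h` is the experiment that starts from the empty
history, with `h` prepended to its histories. -/
theorem expect_append (n : ℕ) (f : List Bool → ℝ) (h g : List Bool) :
    expect r n f (h ++ g) = expect (fun l => r (h ++ l)) n (fun l => f (h ++ l)) g := by
  induction n generalizing g with
  | zero => rfl
  | succ n ih => simp only [expect, List.append_assoc, ih]

theorem expect_congr_prob {r' : List Bool → ℝ} (n : ℕ) (f : List Bool → ℝ) (h : List Bool)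
    (hr : ∀ l : List Bool, l.length < n → r (h ++ l) = r' (h ++ l)) :
    expect r n f h = expect r' n f h := by
  induction n generalizing h with
  | zero => rfl
  | succ n ih =>
    have key : ∀ b, expect r n f (h ++ [b]) = expect r' n f (h ++ [b]) := fun b =>
      ih _ fun l hl => by simpa using hr (b :: l) (by simpa using hl)
    have h0 : r h = r' h := by simpa using hr [] (by simp)
    simp only [expect, key, h0]

/-- A function of the history that does not increase on average over two consecutive questions
does not increase on average over any number of such pairs. -/
theorem expect_pairs_le (hr : ∀ h, r h ∈ Set.Icc (0 : ℝ) 1) {G : List Bool → ℝ}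
    (hG : ∀ h, Even h.length → expect r 2 G h ≤ G h) (T : ℕ) (h : List Bool)
    (hh : Even h.length) : expect r (2 * T) G h ≤ G h := by
  induction T with
  | zero => exact le_rfl
  | succ T ih =>
    rw [Nat.mul_succ, expect_add]
    refine le_trans (expect_mono hr _ _ fun l hl => hG _ ?_) ih
    rw [List.length_append, hl]
    exact hh.add (even_two_mul T)

end Expect

section Answers

variable (q : List Bool → Set ℝ)

open Classical in
theorem answers_concat (xs : List ℝ) (x : ℝ) :
    answers q (xs ++ [x]) = answers q xs ++ [decide (x ∈ q (answers q xs))] := by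
  unfold answers
  rw [List.foldl_append]
  rfl

theorem length_answers (xs : List ℝ) : (answers q xs).length = xs.length := by
  induction xs using List.reverseRecOn with
  | nil => simp [answers]
  | append_singleton xs x ih => rw [answers_concat]; simp [ih]

theorem answers_append (xs ys : List ℝ) :
    answers q (xs ++ ys) = answers q xs ++ answers (fun h => q (answers q xs ++ h)) ys := by
  induction ys using List.reverseRecOn with
  | nil => simp [answers]
  | append_singleton ys y ih =>
    rw [← List.append_assoc, answers_concat, ih, answers_concat]
    simp

open Classical in
theorem answers_cons (x : ℝ) (xs : List ℝ) :
    answers q (x :: xs) = decide (x ∈ q []) :: answers (fun h => q (decide (x ∈ q []) :: h)) xs :=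
  answers_append q [x] xs

theorem answers_congr {q q' : List Bool → Set ℝ} (xs : List ℝ)
    (h : ∀ l : List Bool, l.length < xs.length → q l = q' l) : answers q xs = answers q' xs := by
  induction xs using List.reverseRecOn with
  | nil => rfl
  | append_singleton xs x ih =>
    have h1 := ih fun l hl => h l (by simp; omega)
    rw [answers_concat, answers_concat, h1, h (answers q' xs) (by simp [length_answers])]

theorem take_answers (xs : List ℝ) (n : ℕ) :
    (answers q xs).take n = answers q (xs.take n) := by
  conv_lhs => rw [← List.take_append_drop n xs, answers_append]
  rcases le_total n xs.length with h | h
  · rw [List.take_append_of_le_length (by simp [length_answers, h]),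
      List.take_of_length_le (by simp [length_answers])]
  · rw [List.drop_eq_nil_of_le h, List.take_of_length_le]
    · exact List.append_nil _
    · simp [length_answers, h]

open Classical in
theorem getElem_answers (xs : List ℝ) (i : ℕ) (hi : i < xs.length) :
    (answers q xs)[i]'(by simpa [length_answers] using hi) =
      decide (xs[i] ∈ q ((answers q xs).take i)) := by
  have h1 : (answers q xs).take (i + 1) = (answers q xs).take i ++
      [decide (xs[i] ∈ q ((answers q xs).take i))] := by
    rw [take_answers, take_answers, ← List.take_concat_get' _ _ hi, answers_concat]
  have hl : i < (answers q xs).length := by simpa [length_answers] using hi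
  rw [← List.take_concat_get' _ _ hl] at h1
  exact (List.cons.inj (List.append_cancel_left h1)).1

end Answers

section Measurability

variable {Ω : Type*} [MeasurableSpace Ω] {q : Ω → List Bool → Set ℝ}

theorem measurableSet_answers_eq (hq : ∀ h, MeasurableSet {p : Ω × ℝ | p.2 ∈ q p.1 h})
    (xs : List (Ω → ℝ)) (hxs : ∀ x ∈ xs, Measurable x) (g : List Bool) :
    MeasurableSet {ω | answers (q ω) (xs.map fun x => x ω) = g} := by
  induction xs using List.reverseRecOn generalizing g with
  | nil => simp [answers]
  | append_singleton xs x ih =>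
    simp only [List.map_append, List.map_cons, List.map_nil, answers_concat]
    rcases List.eq_nil_or_concat g with rfl | ⟨g', b, rfl⟩
    · simp
    · have h1 := ih (fun y hy => hxs y (by simp [hy])) g'
      have h2 : MeasurableSet {ω | x ω ∈ q ω g'} :=
        (measurable_id.prodMk (hxs x (by simp))) (hq g')
      have h3 : MeasurableSet {ω | (x ω ∈ q ω g') ↔ b = true} := by
        cases b
        · convert h2.compl using 1
          ext ω
          simp
        · simpa using h2
      convert h1.inter h3 using 1
      ext ω
      simp only [List.concat_eq_append, Set.mem_ofPred_eq, Set.mem_inter_iff]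
      constructor
      · intro h
        obtain ⟨h4, h5⟩ := List.append_inj' h rfl
        rw [h4] at h5
        refine ⟨h4, ?_⟩
        cases b <;> simpa using h5
      · rintro ⟨h4, h5⟩
        rw [h4]
        cases b <;> simpa using h5

theorem measurableSet_answers_ofFn (hq : ∀ h, MeasurableSet {p : Ω × ℝ | p.2 ∈ q p.1 h})
    (n : ℕ) (g : List Bool) :
    MeasurableSet {p : Ω × (Fin n → ℝ) | answers (q p.1) (List.ofFn p.2) = g} := by
  have := measurableSet_answers_eq (Ω := Ω × (Fin n → ℝ)) (q := fun p => q p.1)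
    (fun h => (((measurable_fst.comp measurable_fst).prodMk measurable_snd) :
      Measurable fun p : (Ω × (Fin n → ℝ)) × ℝ => (p.1.1, p.2)) (hq h))
    (List.ofFn fun i => fun p : Ω × (Fin n → ℝ) => p.2 i)
    (by
      intro x hx
      obtain ⟨i, rfl⟩ := (List.mem_ofFn' _ _).1 hx
      fun_prop) g
  simpa [List.map_ofFn, Function.comp_def] using this

theorem OneBitProtocol.measurable_run {α : Type} [MeasurableSpace α] (P : OneBitProtocol α) :
    Measurable fun p : P.Seed × (Fin P.n → ℝ) => P.run p.1 p.2 := by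
  intro S hS
  have : (fun p : P.Seed × (Fin P.n → ℝ) => P.run p.1 p.2) ⁻¹' S =
      ⋃ h : List Bool, {p | answers (P.query p.1) (List.ofFn p.2) = h} ∩
        {p | P.output p.1 h ∈ S} := by
    ext p
    simp [OneBitProtocol.run]
  rw [this]
  exact MeasurableSet.iUnion fun h =>
    (measurableSet_answers_ofFn P.measurableSet_query _ h).inter
      (((P.measurable_output h).comp measurable_fst) hS)

end Measurability

open Classical in
/-- The law of the answers to an adaptive strategy on i.i.d. samples. -/
theorem pi_real_answers_mem (D : Measure ℝ) [IsProbabilityMeasure D] (n : ℕ)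
    {q : List Bool → Set ℝ} (hq : ∀ h, MeasurableSet (q h)) (S : Set (List Bool)) :
    (Measure.pi fun _ : Fin n => D).real {X | answers q (List.ofFn X) ∈ S} =
      expect (fun h => D.real (q h)) n (fun h => if h ∈ S then 1 else 0) [] := by
  induction n generalizing q S with
  | zero => by_cases h : [] ∈ S <;> simp [expect, answers, h, measureReal_def]
  | succ n ih =>
    have hmeas : ∀ (m : ℕ) (q : List Bool → Set ℝ) (_ : ∀ h, MeasurableSet (q h))
        (S : Set (List Bool)),
        MeasurableSet {X : Fin m → ℝ | answers q (List.ofFn X) ∈ S} := by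
      intro m q hq S
      have h1 : {X : Fin m → ℝ | answers q (List.ofFn X) ∈ S} =
          ⋃ g ∈ S, {X | answers q (List.ofFn X) = g} := by ext; simp
      rw [h1]
      refine MeasurableSet.biUnion S.to_countable fun g _ => ?_
      have h2 := measurableSet_answers_ofFn (Ω := Unit) (q := fun _ => q)
        (fun h => measurable_snd (hq h)) m g
      exact (measurable_prodMk_left (x := ())) h2
    let Sb : Bool → Set (List Bool) := fun b => {h | b :: h ∈ S}
    let A : Bool → Set (Fin n → ℝ) := fun b =>
      {X | answers (fun h => q (b :: h)) (List.ofFn X) ∈ Sb b}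
    have hA : ∀ b, MeasurableSet (A b) := fun b => hmeas n _ (fun h => hq _) _
    have hmp := measurePreserving_piFinSuccAbove (fun _ : Fin (n + 1) => D) 0
    have hset : {X : Fin (n + 1) → ℝ | answers q (List.ofFn X) ∈ S} =
        (MeasurableEquiv.piFinSuccAbove (fun _ : Fin (n + 1) => ℝ) 0) ⁻¹'
          ((q [] ×ˢ A true) ∪ ((q [])ᶜ ×ˢ A false)) := by
      ext X
      have h0 : List.ofFn X = X 0 :: List.ofFn (Fin.removeNth 0 X) := by
        rw [List.ofFn_succ]; rfl
      have h1 : (MeasurableEquiv.piFinSuccAbove (fun _ : Fin (n + 1) => ℝ) 0) X =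
        (X 0, Fin.removeNth 0 X) := rfl
      rw [Set.mem_preimage, h1, Set.mem_ofPred_eq, h0, answers_cons]
      by_cases hx : X 0 ∈ q []
      · simp [hx, A, Sb]
      · simp [hx, A, Sb]
    have hdisj : Disjoint (q [] ×ˢ A true) ((q [])ᶜ ×ˢ A false) :=
      Set.disjoint_left.2 fun p h1 h2 => h2.1 h1.1
    rw [measureReal_def, hset, hmp.measure_preimage_equiv, ← measureReal_def,
      measureReal_union hdisj ((hq []).compl.prod (hA false)), measureReal_prod_prod,
      measureReal_prod_prod, probReal_compl_eq_one_sub (hq [])]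
    have key : ∀ b, (Measure.pi fun _ : Fin n => D).real (A b) =
        expect (fun h => D.real (q h)) n (fun h => if h ∈ S then 1 else 0) [b] := by
      intro b
      rw [show A b = {X | answers (fun h => q (b :: h)) (List.ofFn X) ∈ Sb b} from rfl,
        ih (q := fun h => q (b :: h)) (fun h => hq _)]
      exact (expect_append (r := fun h => D.real (q h)) n
        (fun h => if h ∈ S then 1 else 0) [b] []).symm
    have h1 := key true
    have h2 := key false
    simp only [expect, List.nil_append]
    rw [← h1, ← h2]

/-! ### Noisy binary search by multiplicative weights -/

/-- The median of the weights `f 0, …, f (N - 1)`: the least index at which the partial sum reaches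
half of the total. The alternative `N ≤ k + 1` bounds it by `N - 1` whatever `f` is. -/
noncomputable def weightedMedian (N : ℕ) (f : ℕ → ℝ) : ℕ :=
  sInf {k | N ≤ k + 1 ∨ ∑ j ∈ Finset.range N, f j ≤ 2 * ∑ j ∈ Finset.range (k + 1), f j}

section Median

variable {N : ℕ} {f : ℕ → ℝ}

theorem weightedMedian_lt (hN : 0 < N) : weightedMedian N f < N := by
  have : weightedMedian N f ≤ N - 1 := Nat.sInf_le (Or.inl (by omega))
  omega

theorem half_le_sum_le_weightedMedian (hf : ∀ j, 0 ≤ f j) :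
    ∑ j ∈ Finset.range N, f j ≤ 2 * ∑ j ∈ Finset.range (weightedMedian N f + 1), f j := by
  have hne : {k | N ≤ k + 1 ∨ ∑ j ∈ Finset.range N, f j ≤
      2 * ∑ j ∈ Finset.range (k + 1), f j}.Nonempty := ⟨N, Or.inl (by omega)⟩
  rcases Nat.sInf_mem hne with h | h
  · have h1 : ∑ j ∈ Finset.range N, f j ≤ ∑ j ∈ Finset.range (weightedMedian N f + 1), f j :=
      Finset.sum_le_sum_of_subset_of_nonneg (Finset.range_subset_range.2 h) fun i _ _ => hf i
    have h2 : 0 ≤ ∑ j ∈ Finset.range (weightedMedian N f + 1), f j :=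
      Finset.sum_nonneg fun i _ => hf i
    linarith
  · exact h

theorem sum_lt_weightedMedian_le_half (hf : ∀ j, 0 ≤ f j) :
    2 * ∑ j ∈ Finset.range (weightedMedian N f), f j ≤ ∑ j ∈ Finset.range N, f j := by
  rcases Nat.eq_zero_or_pos (weightedMedian N f) with h | h
  · rw [h]
    simpa using Finset.sum_nonneg fun i _ => hf i
  · have h1 := Nat.notMem_of_lt_sInf
      (show weightedMedian N f - 1 < sInf _ from Nat.sub_lt h one_pos)
    rw [Set.mem_ofPred_eq, not_or, not_le, not_le, Nat.sub_add_cancel h] at h1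
    exact h1.2.le

/-- A set of indices that is an interval and carries more than half of the weight contains the
median. -/
theorem weightedMedian_mem_of_ordConnected (hN : 0 < N) (hf : ∀ j, 0 ≤ f j) {S : Set ℕ}
    [DecidablePred (· ∈ S)] (hS : S.OrdConnected)
    (h : 2 * ∑ j ∈ Finset.range N with j ∉ S, f j < ∑ j ∈ Finset.range N, f j) :
    weightedMedian N f ∈ S := by
  set m := weightedMedian N f with hm
  by_contra hmS
  have hsplit := Finset.sum_filter_add_sum_filter_not (Finset.range N) (· ∈ S) f
  -- All of `S` lies on one side of the median.
  have hside : (∀ j ∈ S, j < m) ∨ ∀ j ∈ S, m < j := by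
    by_contra! hc
    obtain ⟨⟨a, ha, ha'⟩, b, hb, hb'⟩ := hc
    exact hmS (hS.out hb ha ⟨hb', ha'⟩)
  have hmN : m < N := weightedMedian_lt hN
  rcases hside with hs | hs
  · have h1 := sum_lt_weightedMedian_le_half (N := N) hf
    have h2 : ∑ j ∈ Finset.range N with j ∈ S, f j ≤ ∑ j ∈ Finset.range m, f j :=
      Finset.sum_le_sum_of_subset_of_nonneg (fun j hj => by
        simp only [Finset.mem_filter, Finset.mem_range] at hj ⊢
        exact hs j hj.2) fun i _ _ => hf i
    linarith
  · have h1 := half_le_sum_le_weightedMedian (N := N) hf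
    have h2 : ∑ j ∈ Finset.range (m + 1), f j ≤ ∑ j ∈ Finset.range N with j ∉ S, f j :=
      Finset.sum_le_sum_of_subset_of_nonneg (fun j hj => by
        simp only [Finset.mem_filter, Finset.mem_range] at hj ⊢
        refine ⟨by omega, fun hjS => ?_⟩
        have := hs j hjS
        omega) fun i _ _ => hf i
    linarith

end Median

/-- The factor by which the weights on the right of a point are multiplied after the answer `b` to
the question whether the sample lies on the left of that point. For a response probability `τ` its
mean is `1`. The step size `1e-4` is small compared with the margin `0.005` of the search, so that
the bias of a clearly misplaced point outweighs the second-order terms. -/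
noncomputable def tilt (τ : ℝ) (b : Bool) : ℝ :=
  if b then 1 - (1 - τ) * 1e-4 else 1 + τ * 1e-4

/-- The weights of the gaps after the answer `b` at the left end point of gap `i`. -/
noncomputable def reweight (τ : ℝ) (w : ℕ → ℝ) (i : ℕ) (b : Bool) : ℕ → ℝ :=
  fun j => if i ≤ j then w j * tilt τ b else w j

/-- The state of the search among the gaps `[j, j + 1]`, `j < N`: their weights, the number of
rounds in which each gap was under scrutiny, the gap under scrutiny, and whether its left end point
has already been queried in the current round. -/
structure SearchState where
  weight : ℕ → ℝ
  votes : ℕ → ℝ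
  gap : ℕ
  second : Bool

/-- The point to be queried next: an end point of the gap under scrutiny. -/
def SearchState.point (s : SearchState) : ℕ := s.gap + s.second.toNat

/-- In each round both end points of the median gap are queried; after that the gap gets a vote. -/
noncomputable def SearchState.step (τ : ℝ) (N : ℕ) (s : SearchState) (b : Bool) : SearchState :=
  if s.second then
    { weight := reweight τ s.weight s.point b
      votes := s.votes + Pi.single s.gap 1
      gap := weightedMedian N (reweight τ s.weight s.point b)
      second := false }
  else
    { weight := reweight τ s.weight s.point b
      votes := s.votes
      gap := s.gap
      second := true }

/-- The state of the search after given answers; all weights are equal at the beginning. -/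
noncomputable def searchState (τ : ℝ) (N : ℕ) (h : List Bool) : SearchState :=
  h.foldl (SearchState.step τ N)
    { weight := 1
      votes := 0
      gap := weightedMedian N 1
      second := false }

/-- The gap found by the search: the median vote. -/
noncomputable def searchResult (τ : ℝ) (N : ℕ) (h : List Bool) : ℕ :=
  weightedMedian N (searchState τ N h).votes

section Search

variable {τ : ℝ} {N : ℕ}

theorem searchState_concat (h : List Bool) (b : Bool) :
    searchState τ N (h ++ [b]) = (searchState τ N h).step τ N b := by
  simp [searchState]

theorem tilt_pos (hτ : τ ∈ Set.Icc (0 : ℝ) 1) (b : Bool) : 0 < tilt τ b := by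
  obtain ⟨h0, h1⟩ := hτ
  cases b <;> simp only [tilt] <;> norm_num <;> linarith

theorem searchState_gap_lt (hN : 0 < N) (h : List Bool) : (searchState τ N h).gap < N := by
  induction h using List.reverseRecOn with
  | nil => exact weightedMedian_lt hN
  | append_singleton h b ih =>
    rw [searchState_concat, SearchState.step]
    split_ifs
    · exact weightedMedian_lt hN
    · exact ih

theorem searchState_weight_pos (hτ : τ ∈ Set.Icc (0 : ℝ) 1) (h : List Bool) (j : ℕ) :
    0 < (searchState τ N h).weight j := by
  induction h using List.reverseRecOn with
  | nil => simp [searchState]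
  | append_singleton h b ih =>
    have h1 : ∀ i, 0 < reweight τ (searchState τ N h).weight i b j := by
      intro i
      rw [reweight]
      split_ifs
      · exact mul_pos ih (tilt_pos hτ b)
      · exact ih
    rw [searchState_concat, SearchState.step]
    split_ifs <;> exact h1 _

theorem searchState_votes_nonneg (h : List Bool) (j : ℕ) : 0 ≤ (searchState τ N h).votes j := by
  induction h using List.reverseRecOn with
  | nil => simp [searchState]
  | append_singleton h b ih =>
    rw [searchState_concat, SearchState.step]
    split_ifs
    · refine add_nonneg ih ?_
      by_cases hj : j = (searchState τ N h).gap
      · simp [hj]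
      · simp [hj]
    · exact ih

theorem searchState_of_even (h : List Bool) :
    ((searchState τ N h).second = true ↔ ¬ Even h.length) ∧
      (Even h.length → (searchState τ N h).gap = weightedMedian N (searchState τ N h).weight) := by
  induction h using List.reverseRecOn with
  | nil => simp [searchState]
  | append_singleton h b ih =>
    rw [searchState_concat, SearchState.step, List.length_append, List.length_singleton,
      Nat.even_add_one]
    split_ifs with hs
    · exact ⟨by simpa using ih.1.1 hs, fun _ => rfl⟩
    · have : Even h.length := by simpa using (not_congr ih.1).1 hs
      simp [this]

theorem searchState_concat_two {h : List Bool} (hh : Even h.length) (b b' : Bool) :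
    searchState τ N (h ++ [b] ++ [b']) =
      { weight := reweight τ (reweight τ (searchState τ N h).weight (searchState τ N h).gap b)
          ((searchState τ N h).gap + 1) b'
        votes := (searchState τ N h).votes + Pi.single (searchState τ N h).gap 1
        gap := weightedMedian N (reweight τ (reweight τ (searchState τ N h).weight
          (searchState τ N h).gap b) ((searchState τ N h).gap + 1) b')
        second := false } := by
  have h1 : (searchState τ N h).second = false := by
    have := (searchState_of_even (τ := τ) (N := N) h).1
    cases hs : (searchState τ N h).second
    · rfl
    · exact absurd hh (this.1 hs)
  rw [searchState_concat, searchState_concat]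
  simp [SearchState.step, h1, SearchState.point]

theorem sum_searchState_votes (hN : 0 < N) (T : ℕ) {h : List Bool} (hh : h.length = 2 * T) :
    ∑ j ∈ Finset.range N, (searchState τ N h).votes j = T := by
  induction T generalizing h with
  | zero =>
    have : h = [] := List.length_eq_zero_iff.1 (by omega)
    simp [this, searchState]
  | succ T ih =>
    obtain ⟨h', b', rfl⟩ := (List.eq_nil_or_concat h).resolve_left (by
      rintro rfl; simp at hh)
    obtain ⟨h'', b, rfl⟩ := (List.eq_nil_or_concat h').resolve_left (by
      rintro rfl; simp at hh; omega)
    simp only [List.concat_eq_append, List.length_append, List.length_singleton] at hh ⊢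
    have hl : h''.length = 2 * T := by omega
    rw [searchState_concat_two (by rw [hl]; exact even_two_mul T)]
    simp only [Pi.add_apply, Finset.sum_add_distrib, ih hl, Pi.single_apply, Finset.sum_ite_eq',
      Finset.mem_range, searchState_gap_lt hN, if_true]
    push_cast; ring

end Search

/-- The factor by which the answer `b` at point `i` changes the weight of gap `j` relative to that
of gap `t`. -/
noncomputable def relTilt (τ : ℝ) (t i j : ℕ) (b : Bool) : ℝ :=
  (if i ≤ j then tilt τ b else 1) / (if i ≤ t then tilt τ b else 1)

/-- The mean of `relTilt` when the response probability at point `i` is `p i`. -/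
noncomputable def meanTilt (p : ℕ → ℝ) (τ : ℝ) (t i j : ℕ) : ℝ :=
  p i * relTilt τ t i j true + (1 - p i) * relTilt τ t i j false

theorem sum_mul_le_of_half {ι : Type*} {s u : Finset ι} {v B : ι → ℝ} {d : ℝ} (hu : u ⊆ s)
    (hv : ∀ j ∈ s, 0 ≤ v j) (hB : ∀ j ∈ s, B j ≤ 1) (hBu : ∀ j ∈ u, B j ≤ 1 - 2 * d) (hd : 0 ≤ d)
    (hhalf : ∑ j ∈ s, v j ≤ 2 * ∑ j ∈ u, v j) :
    ∑ j ∈ s, v j * B j ≤ (1 - d) * ∑ j ∈ s, v j := by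
  classical
  have h1 : ∑ j ∈ s, v j * B j ≤ ∑ j ∈ s, (v j - if j ∈ u then 2 * d * v j else 0) := by
    refine Finset.sum_le_sum fun j hj => ?_
    have hvj := hv j hj
    split_ifs with hju
    · nlinarith [hBu j hju]
    · nlinarith [hB j hj]
  have h2 : ∑ j ∈ s, (if j ∈ u then 2 * d * v j else 0) = 2 * d * ∑ j ∈ u, v j := by
    rw [← Finset.sum_filter, Finset.filter_mem_eq_inter, Finset.inter_eq_right.2 hu,
      Finset.mul_sum]
  rw [Finset.sum_sub_distrib, h2] at h1
  nlinarith

section Potential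

variable {τ : ℝ} {N t : ℕ} {p : ℕ → ℝ}

theorem relTilt_pos (hτ : τ ∈ Set.Icc (0.49 : ℝ) 0.51) (i j : ℕ) (b : Bool) :
    0 < relTilt τ t i j b := by
  have := tilt_pos ⟨by linarith [hτ.1], by linarith [hτ.2]⟩ b
  unfold relTilt
  split_ifs <;> positivity

theorem meanTilt_nonneg (hτ : τ ∈ Set.Icc (0.49 : ℝ) 0.51) {i : ℕ} (hp : p i ∈ Set.Icc (0 : ℝ) 1)
    (j : ℕ) : 0 ≤ meanTilt p τ t i j :=
  add_nonneg (mul_nonneg hp.1 (relTilt_pos hτ i j _).le)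
    (mul_nonneg (by linarith [hp.2]) (relTilt_pos hτ i j _).le)

theorem meanTilt_of_same_side (hτ : τ ∈ Set.Icc (0.49 : ℝ) 0.51) {i j : ℕ} (h : i ≤ j ↔ i ≤ t) :
    meanTilt p τ t i j = 1 := by
  have h1 : ∀ b, relTilt τ t i j b = 1 := by
    intro b
    have := tilt_pos ⟨by linarith [hτ.1], by linarith [hτ.2]⟩ b
    unfold relTilt
    by_cases hj : i ≤ j
    · rw [if_pos hj, if_pos (h.1 hj), div_self this.ne']
    · rw [if_neg hj, if_neg fun ht => hj (h.2 ht), div_one]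
  simp [meanTilt, h1]

/-- To first order the tilts balance out at the response probability `τ`. -/
theorem meanTilt_of_target_left {i j : ℕ} (hj : i ≤ j) (ht : t < i) :
    meanTilt p τ t i j = 1 - 1e-4 * (p i - τ) := by
  simp only [meanTilt, relTilt, if_pos hj, if_neg ht.not_ge, tilt]
  norm_num
  ring

theorem meanTilt_of_target_right (hτ : τ ∈ Set.Icc (0.49 : ℝ) 0.51) {i j : ℕ}
    (hp : p i ∈ Set.Icc (0 : ℝ) 1) (hj : j < i) (ht : i ≤ t) :
    meanTilt p τ t i j ≤ 1 + 1e-4 * (p i - τ) + 1e-8 := by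
  obtain ⟨h0, h1⟩ := hτ
  have hx : 1 / (1 - (1 - τ) * 1e-4) ≤ 1 + (1 - τ) * 1e-4 + 1e-8 := by
    rw [div_le_iff₀ (by norm_num; linarith)]
    nlinarith
  have hy : 1 / (1 + τ * 1e-4) ≤ 1 - τ * 1e-4 + 1e-8 := by
    rw [div_le_iff₀ (by norm_num; linarith)]
    nlinarith
  simp only [meanTilt, relTilt, if_neg hj.not_ge, if_pos ht, tilt, if_true, Bool.false_eq_true,
    if_false]
  have h2 := mul_le_mul_of_nonneg_left hx hp.1
  have h3 := mul_le_mul_of_nonneg_left hy (sub_nonneg.2 hp.2)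
  linarith

variable (hτ : τ ∈ Set.Icc (0.49 : ℝ) 0.51) (hp : ∀ i, p i ∈ Set.Icc (0 : ℝ) 1)
  (hlt : ∀ i ≤ t, p i < τ) (hge : ∀ i, t < i → τ ≤ p i)

include hτ hp hlt hge

theorem meanTilt_le (i j : ℕ) : meanTilt p τ t i j ≤ 1 + 1e-8 := by
  rcases le_or_gt i j with hj | hj <;> rcases le_or_gt i t with ht | ht
  · rw [meanTilt_of_same_side hτ (iff_of_true hj ht)]; norm_num
  · rw [meanTilt_of_target_left hj ht]; linarith [hge i ht]
  · linarith [meanTilt_of_target_right hτ (hp i) hj ht, hlt i ht]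
  · rw [meanTilt_of_same_side hτ (iff_of_false hj.not_ge ht.not_ge)]; norm_num

omit hp hge in
theorem meanTilt_le_of_high {i : ℕ} (hi : τ + 0.005 ≤ p i) (j : ℕ) :
    meanTilt p τ t i j ≤ 1 ∧ (i ≤ j → meanTilt p τ t i j ≤ 1 - 2 * 2.45e-7) := by
  have ht : t < i := by
    by_contra! h
    linarith [hlt i h]
  rcases le_or_gt i j with hj | hj
  · rw [meanTilt_of_target_left hj ht]
    exact ⟨by linarith, fun _ => by linarith⟩
  · rw [meanTilt_of_same_side hτ (iff_of_false hj.not_ge ht.not_ge)]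
    exact ⟨le_rfl, fun h => absurd h hj.not_ge⟩

omit hlt in
theorem meanTilt_le_of_low {i : ℕ} (hi : p i ≤ τ - 0.005) (j : ℕ) :
    meanTilt p τ t i j ≤ 1 ∧ (j < i → meanTilt p τ t i j ≤ 1 - 2 * 2.45e-7) := by
  have ht : i ≤ t := by
    by_contra! h
    linarith [hge i h]
  rcases le_or_gt i j with hj | hj
  · rw [meanTilt_of_same_side hτ (iff_of_true hj ht)]
    exact ⟨le_rfl, fun h => absurd hj h.not_ge⟩
  · have := meanTilt_of_target_right hτ (hp i) hj ht
    exact ⟨by linarith, fun _ => by linarith⟩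

/-- Averaged over the answers at both end points of a gap `k`, the sum of the weights
relative to the weight of the target gap `t` grows at most by a tiny factor. -/
theorem sum_mul_meanTilt_le {v : ℕ → ℝ} (hv : ∀ j, 0 ≤ v j) (k : ℕ) :
    ∑ j ∈ Finset.range N, v j * (meanTilt p τ t k j * meanTilt p τ t (k + 1) j) ≤
      Real.exp 3e-8 * ∑ j ∈ Finset.range N, v j := by
  rw [Finset.mul_sum]
  refine Finset.sum_le_sum fun j _ => ?_
  rw [mul_comm]
  refine mul_le_mul_of_nonneg_right ?_ (hv j)
  calc meanTilt p τ t k j * meanTilt p τ t (k + 1) j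
      ≤ (1 + 1e-8) * (1 + 1e-8) := mul_le_mul (meanTilt_le hτ hp hlt hge k j)
        (meanTilt_le hτ hp hlt hge _ j) (meanTilt_nonneg hτ (hp _) j) (by norm_num)
    _ ≤ 3e-8 + 1 := by norm_num
    _ ≤ Real.exp 3e-8 := Real.add_one_le_exp _

/-- If the response probability crosses `τ` well to the left or well to the right of the median gap
`k`, then on average the sum of the weights relative to the weight of the target gap shrinks,
because at least half of the weight is on the wrong side of an end point of `k`. -/
theorem sum_mul_meanTilt_le_of_bad (hmono : Monotone p) {v : ℕ → ℝ} (hv : ∀ j, 0 ≤ v j) {k : ℕ}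
    (hk : k = weightedMedian N v) (hN : 0 < N)
    (hbad : ¬ (p k < τ + 0.005 ∧ τ - 0.005 < p (k + 1))) :
    ∑ j ∈ Finset.range N, v j * (meanTilt p τ t k j * meanTilt p τ t (k + 1) j) ≤
      Real.exp (-2.45e-7) * ∑ j ∈ Finset.range N, v j := by
  have hkN : k < N := hk ▸ weightedMedian_lt hN
  have hnn := fun i j => meanTilt_nonneg (t := t) hτ (hp i) j
  have key : ∑ j ∈ Finset.range N, v j * (meanTilt p τ t k j * meanTilt p τ t (k + 1) j) ≤
      (1 - 2.45e-7) * ∑ j ∈ Finset.range N, v j := by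
    rw [not_and_or, not_lt, not_lt] at hbad
    rcases hbad with h | h
    · have h0 := meanTilt_le_of_high hτ hlt h
      have h1 := meanTilt_le_of_high hτ hlt (h.trans (hmono k.le_succ))
      refine sum_mul_le_of_half (u := (Finset.range N).filter (k ≤ ·))
        (Finset.filter_subset _ _) (fun j _ => hv j) (fun j _ => ?_) (fun j hj => ?_)
        (by norm_num) ?_
      · exact mul_le_one₀ (h0 j).1 (hnn _ _) (h1 j).1
      · exact (mul_le_of_le_one_right (hnn _ _) (h1 j).1).trans
          ((h0 j).2 (Finset.mem_filter.1 hj).2)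
      · have h2 := sum_lt_weightedMedian_le_half (N := N) hv
        rw [← hk] at h2
        have h3 := Finset.sum_filter_add_sum_filter_not (Finset.range N) (k ≤ ·) v
        have h4 : (Finset.range N).filter (fun j => ¬ k ≤ j) = Finset.range k := by
          ext j; simp only [Finset.mem_filter, Finset.mem_range]; omega
        rw [h4] at h3
        linarith
    · have h0 := meanTilt_le_of_low hτ hp hge ((hmono k.le_succ).trans h)
      have h1 := meanTilt_le_of_low hτ hp hge h
      refine sum_mul_le_of_half (u := Finset.range (k + 1))
        (Finset.range_subset_range.2 hkN) (fun j _ => hv j) (fun j _ => ?_) (fun j hj => ?_)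
        (by norm_num) ?_
      · exact mul_le_one₀ (h0 j).1 (hnn _ _) (h1 j).1
      · exact (mul_le_of_le_one_left (hnn _ _) (h0 j).1).trans ((h1 j).2 (Finset.mem_range.1 hj))
      · have h2 := half_le_sum_le_weightedMedian (N := N) hv
        rwa [← hk] at h2
  refine key.trans (mul_le_mul_of_nonneg_right ?_ (Finset.sum_nonneg fun j _ => hv j))
  linarith [Real.add_one_le_exp (-2.45e-7 : ℝ)]

end Potential

section Supermartingale

/-- The gaps `[k, k + 1]` that meet the interval of radius `0.005` about `τ`. -/
def crossingGaps (p : ℕ → ℝ) (τ : ℝ) : Set ℕ := {k | p k < τ + 0.005 ∧ τ - 0.005 < p (k + 1)}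

/-- The potential of a history: the reciprocal of the normalized weight of the target gap `t`,
increased for each vote for a gap outside `crossingGaps`, and discounted for each answer. The rate
`2.3e-7` is less than the decrease `2.45e-7` of the logarithm in such a round plus the discount
`3e-8` of a round, and this discount makes up for the growth in the other rounds. -/
noncomputable def potential (p : ℕ → ℝ) (τ : ℝ) (N t : ℕ) (h : List Bool) : ℝ :=
  open Classical in
  (∑ j ∈ Finset.range N, (searchState τ N h).weight j / (searchState τ N h).weight t) *
    Real.exp (2.3e-7 * (∑ j ∈ Finset.range N with j ∉ crossingGaps p τ,
      (searchState τ N h).votes j) - 1.5e-8 * h.length)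

variable {τ : ℝ} {N t : ℕ} {p : ℕ → ℝ}

theorem ordConnected_crossingGaps (hmono : Monotone p) : (crossingGaps p τ).OrdConnected :=
  ⟨fun _ hx _ hy _ hz => ⟨(hmono hz.2).trans_lt hy.1,
    hx.2.trans_le (hmono (Nat.add_le_add_right hz.1 1))⟩⟩

theorem reweight_div (hτ : τ ∈ Set.Icc (0.49 : ℝ) 0.51) (w : ℕ → ℝ) (hw : ∀ j, 0 < w j)
    (i j : ℕ) (b : Bool) :
    reweight τ w i b j / reweight τ w i b t = w j / w t * relTilt τ t i j b := by
  have h1 := tilt_pos ⟨by linarith [hτ.1], by linarith [hτ.2]⟩ b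
  have h2 := hw t
  simp only [reweight, relTilt]
  split_ifs <;> field_simp

theorem reweight_pos (hτ : τ ∈ Set.Icc (0.49 : ℝ) 0.51) (w : ℕ → ℝ) (hw : ∀ j, 0 < w j)
    (i : ℕ) (b : Bool) (j : ℕ) : 0 < reweight τ w i b j := by
  have h1 := tilt_pos ⟨by linarith [hτ.1], by linarith [hτ.2]⟩ b
  rw [reweight]
  split_ifs
  · exact mul_pos (hw j) h1
  · exact hw j

variable (hτ : τ ∈ Set.Icc (0.49 : ℝ) 0.51) (hp : ∀ i, p i ∈ Set.Icc (0 : ℝ) 1)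
  (hmono : Monotone p) (hlt : ∀ i ≤ t, p i < τ) (hge : ∀ i, t < i → τ ≤ p i) (hN : 0 < N)

include hτ hp hmono hlt hge hN

/-- The potential does not increase on average over a round. -/
theorem expect_two_potential_le {r : List Bool → ℝ}
    (hr : ∀ h, r h = p (searchState τ N h).point) {h : List Bool} (hh : Even h.length) :
    expect r 2 (potential p τ N t) h ≤ potential p τ N t h := by
  classical
  set s := searchState τ N h with hs
  set k := s.gap with hk
  have hτ' : τ ∈ Set.Icc (0 : ℝ) 1 := ⟨by linarith [hτ.1], by linarith [hτ.2]⟩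
  have hw : ∀ j, 0 < s.weight j := searchState_weight_pos hτ' h
  have hsec : s.second = false := by
    have := (searchState_of_even (τ := τ) (N := N) h).1
    cases hs' : s.second
    · rfl
    · exact absurd hh (this.1 hs')
  have hkN : k < N := searchState_gap_lt hN h
  have hr0 : r h = p k := by
    rw [hr, ← hs, SearchState.point, hsec]
    simp [hk]
  have hr1 : ∀ b, r (h ++ [b]) = p (k + 1) := by
    intro b
    rw [hr, searchState_concat, ← hs, SearchState.step, hsec]
    simp [SearchState.point, hk]
  let v : ℕ → ℝ := fun j => s.weight j / s.weight t
  have hv : ∀ j, 0 ≤ v j := fun j => (div_pos (hw j) (hw t)).le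
  set e : ℝ := 2.3e-7 * (∑ j ∈ Finset.range N with j ∉ crossingGaps p τ, s.votes j) -
    1.5e-8 * h.length with he
  set i : ℝ := if k ∈ crossingGaps p τ then 0 else 1 with hi
  have hpot : ∀ b b', potential p τ N t (h ++ [b] ++ [b']) =
      (∑ j ∈ Finset.range N, v j * (relTilt τ t k j b * relTilt τ t (k + 1) j b')) *
        Real.exp (e + (2.3e-7 * i - 3e-8)) := by
    intro b b'
    rw [potential, searchState_concat_two hh, ← hs, ← hk]
    congr 1
    · refine Finset.sum_congr rfl fun j _ => ?_
      simp only []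
      rw [reweight_div hτ _ (reweight_pos hτ _ hw k b), reweight_div hτ _ hw, mul_assoc]
    · congr 1
      simp only [Pi.add_apply, Finset.sum_add_distrib, Pi.single_apply, Finset.sum_ite_eq',
        Finset.mem_filter, Finset.mem_range, hkN, true_and, List.length_append,
        List.length_singleton]
      rw [he, hi]
      push_cast
      split_ifs <;> ring
  have hexp : expect r 2 (potential p τ N t) h =
      (∑ j ∈ Finset.range N, v j * (meanTilt p τ t k j * meanTilt p τ t (k + 1) j)) *
        Real.exp (e + (2.3e-7 * i - 3e-8)) := by
    simp only [expect, hr0, hr1, hpot, meanTilt]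
    simp only [← mul_assoc, ← add_mul]
    congr 1
    simp only [Finset.mul_sum, mul_add, add_mul, Finset.sum_add_distrib]
    simp only [← Finset.sum_add_distrib]
    exact Finset.sum_congr rfl fun j _ => by ring
  have hpot0 : potential p τ N t h = (∑ j ∈ Finset.range N, v j) * Real.exp e := by
    rw [potential]
  have hmed : k = weightedMedian N v := by
    have h1 : k = weightedMedian N s.weight := (searchState_of_even h).2 hh
    have h2 : ∀ a b : ℝ, a / s.weight t ≤ 2 * (b / s.weight t) ↔ a ≤ 2 * b := by
      intro a b
      rw [← mul_div_assoc, div_le_div_iff_of_pos_right (hw t)]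
    rw [h1]
    simp only [weightedMedian, v, ← Finset.sum_div, h2]
  have hsum : 0 ≤ ∑ j ∈ Finset.range N, v j := Finset.sum_nonneg fun j _ => hv j
  rw [hexp, hpot0]
  have hstep : ∑ j ∈ Finset.range N, v j * (meanTilt p τ t k j * meanTilt p τ t (k + 1) j) ≤
      Real.exp (3e-8 - 2.3e-7 * i) * ∑ j ∈ Finset.range N, v j := by
    by_cases hg : k ∈ crossingGaps p τ
    · rw [hi, if_pos hg, mul_zero, sub_zero]
      exact sum_mul_meanTilt_le hτ hp hlt hge hv k
    · refine (sum_mul_meanTilt_le_of_bad hτ hp hlt hge hmono hv hmed hN hg).trans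
        (mul_le_mul_of_nonneg_right (Real.exp_le_exp.2 ?_) hsum)
      rw [hi, if_neg hg]
      norm_num
  calc _ ≤ (Real.exp (3e-8 - 2.3e-7 * i) * ∑ j ∈ Finset.range N, v j) *
        Real.exp (e + (2.3e-7 * i - 3e-8)) :=
        mul_le_mul_of_nonneg_right hstep (Real.exp_pos _).le
    _ = (∑ j ∈ Finset.range N, v j) * Real.exp e := by
        rw [mul_comm (Real.exp _), mul_assoc, ← Real.exp_add]
        congr 2
        ring

omit hp hmono hlt hge in
/-- If the search fails, then at least half of the votes were for gaps outside `crossingGaps`, which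
makes the potential large. -/
theorem one_le_potential_mul_of_notMem (htN : t < N) {T : ℕ} {h : List Bool}
    (hh : h.length = 2 * T) (hS : searchResult τ N h ∉ crossingGaps p τ)
    (hmono : Monotone p) : 1 ≤ Real.exp (-(8e-8 * T)) * potential p τ N t h := by
  classical
  have hτ' : τ ∈ Set.Icc (0 : ℝ) 1 := ⟨by linarith [hτ.1], by linarith [hτ.2]⟩
  have hw : ∀ j, 0 < (searchState τ N h).weight j := searchState_weight_pos hτ' h
  have hbad : (T : ℝ) ≤ 2 * ∑ j ∈ Finset.range N with j ∉ crossingGaps p τ,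
      (searchState τ N h).votes j := by
    by_contra! hc
    refine hS (weightedMedian_mem_of_ordConnected hN (searchState_votes_nonneg h)
      (ordConnected_crossingGaps hmono) ?_)
    rwa [sum_searchState_votes hN T hh]
  have h1 : 1 ≤ ∑ j ∈ Finset.range N,
      (searchState τ N h).weight j / (searchState τ N h).weight t := by
    have := Finset.single_le_sum (f := fun j => (searchState τ N h).weight j /
      (searchState τ N h).weight t) (fun j _ => (div_pos (hw j) (hw t)).le)
      (Finset.mem_range.2 htN)
    rwa [div_self (hw t).ne'] at this
  rw [potential, mul_left_comm, ← Real.exp_add]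
  refine one_le_mul_of_one_le_of_one_le h1 (Real.one_le_exp ?_)
  rw [hh]
  push_cast
  have : (0 : ℝ) ≤ T := T.cast_nonneg
  linarith

omit hp hmono hlt hge hN in
open Classical in
/-- The search misses `crossingGaps` with a probability that decreases exponentially in the number
`T` of rounds. -/
theorem expect_searchResult_notMem_le (hp : ∀ i, p i ∈ Set.Icc (0 : ℝ) 1) (hmono : Monotone p)
    (h0 : p 0 < τ) (h1 : τ ≤ p N) {r : List Bool → ℝ}
    (hr : ∀ h, r h = p (searchState τ N h).point) (T : ℕ) :
    expect r (2 * T) (fun h => if searchResult τ N h ∈ crossingGaps p τ then 0 else 1) [] ≤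
      N * Real.exp (-(8e-8 * T)) := by
  have hex : ∃ i, τ ≤ p i := ⟨N, h1⟩
  have hpos : 0 < Nat.find hex := by
    rw [Nat.find_pos]
    exact h0.not_ge
  have hfN : Nat.find hex ≤ N := Nat.find_min' hex h1
  -- The target is the gap at which the response probability crosses `τ`.
  obtain ⟨t, ht⟩ : ∃ t, Nat.find hex = t + 1 := ⟨_, (Nat.succ_pred_eq_of_pos hpos).symm⟩
  have hlt : ∀ i ≤ t, p i < τ := fun i hi => not_le.1 (Nat.find_min hex (by omega))
  have hge : ∀ i, t < i → τ ≤ p i := fun i hi =>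
    (Nat.find_spec hex).trans (hmono (by omega))
  have hN : 0 < N := by omega
  have hr01 : ∀ h, r h ∈ Set.Icc (0 : ℝ) 1 := fun h => hr h ▸ hp _
  calc _ ≤ expect r (2 * T) (fun h => Real.exp (-(8e-8 * T)) * potential p τ N t h) [] := by
        refine expect_mono hr01 _ _ fun l hl => ?_
        simp only [List.nil_append]
        split_ifs with hS
        · refine mul_nonneg (Real.exp_pos _).le (mul_nonneg (Finset.sum_nonneg fun j _ => ?_)
            (Real.exp_pos _).le)
          have hw := searchState_weight_pos (τ := τ) (N := N)
            ⟨by linarith [hτ.1], by linarith [hτ.2]⟩ l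
          exact (div_pos (hw j) (hw t)).le
        · exact one_le_potential_mul_of_notMem hτ hN (by omega) hl hS hmono
    _ = Real.exp (-(8e-8 * T)) * expect r (2 * T) (potential p τ N t) [] :=
        expect_const_mul _ _ _ _
    _ ≤ Real.exp (-(8e-8 * T)) * potential p τ N t [] :=
        mul_le_mul_of_nonneg_left (expect_pairs_le hr01
          (fun h hh => expect_two_potential_le hτ hp hmono hlt hge hN hr hh) T []
          (by simp)) (Real.exp_pos _).le
    _ = N * Real.exp (-(8e-8 * T)) := by
        simp [potential, searchState, mul_comm]

end Supermartingale

/-! ### Tails of the distributions in the family -/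

/-- Chebyshev's inequality. -/
theorem real_le_abs_sub_mean_le {lam sig : ℝ} (hsig : 0 < sig) {D : Measure ℝ}
    (hD : D ∈ meanVarFamily lam sig) {t : ℝ} (ht : 0 < t) :
    D.real {x | t * sig ≤ |x - ∫ y, y ∂D|} ≤ 1 / t ^ 2 := by
  obtain ⟨h1, h2, -, h3⟩ := hD
  have h4 := meas_ge_le_variance_div_sq h2 (mul_pos ht hsig)
  have h5 : variance (fun x : ℝ => x) D / (t * sig) ^ 2 ≤ 1 / t ^ 2 := by
    rw [div_le_div_iff₀ (by positivity) (by positivity)]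
    nlinarith [sq_nonneg t, mul_le_mul_of_nonneg_left h3 (sq_nonneg t)]
  rw [measureReal_def]
  exact ENNReal.toReal_le_of_le_ofReal (by positivity)
    (h4.trans (ENNReal.ofReal_le_ofReal h5))

theorem cdf_le_of_add_le_mean {lam sig : ℝ} (hsig : 0 < sig) {D : Measure ℝ}
    (hD : D ∈ meanVarFamily lam sig) {t x : ℝ} (ht : 0 < t) (hx : x + t * sig ≤ ∫ y, y ∂D) :
    cdf D x ≤ 1 / t ^ 2 := by
  have := hD.1
  rw [cdf_eq_real]
  refine (measureReal_mono fun y hy => ?_).trans (real_le_abs_sub_mean_le hsig hD ht)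
  rw [Set.mem_Iic] at hy
  rw [Set.mem_ofPred_eq, abs_sub_comm]
  exact le_trans (by linarith) (le_abs_self _)

theorem le_cdf_of_mean_add_le {lam sig : ℝ} (hsig : 0 < sig) {D : Measure ℝ}
    (hD : D ∈ meanVarFamily lam sig) {t x : ℝ} (ht : 0 < t) (hx : ∫ y, y ∂D + t * sig ≤ x) :
    1 - 1 / t ^ 2 ≤ cdf D x := by
  have := hD.1
  rw [cdf_eq_real, ← compl_compl (Set.Iic x), probReal_compl_eq_one_sub measurableSet_Iic.compl]
  refine sub_le_sub_left ((measureReal_mono fun y hy => ?_).trans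
    (real_le_abs_sub_mean_le hsig hD ht)) 1
  rw [Set.mem_compl_iff, Set.mem_Iic, not_le] at hy
  rw [Set.mem_ofPred_eq]
  exact le_trans (by linarith) (le_abs_self _)

/-! ### The search for the median as a protocol -/

theorem Icc_inter_Ioo_nonempty_iff {a b x y : ℝ} (hab : a < b) (hxy : x ≤ y) :
    (Set.Icc x y ∩ Set.Ioo a b).Nonempty ↔ x < b ∧ a < y := by
  constructor
  · rintro ⟨z, ⟨h1, h2⟩, h3, h4⟩
    exact ⟨h1.trans_lt h4, h3.trans_le h2⟩
  · rintro ⟨h1, h2⟩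
    refine ⟨max x (min y ((a + b) / 2)), ⟨le_max_left _ _, max_le hxy (min_le_left _ _)⟩, ?_, ?_⟩
    · exact lt_max_of_lt_right (lt_min h2 (by linarith))
    · exact max_lt h1 (min_lt_of_right_lt (by linarith))

/-- The number of gaps of the search grid. -/
noncomputable def numGaps (lam sig : ℝ) : ℕ := 2 * (⌈lam / sig⌉₊ + 2)

/-- The points of the search grid, enumerated from left to right. -/
noncomputable def gridPoint (lam sig : ℝ) (i : ℕ) : ℝ := ((i : ℝ) - (⌈lam / sig⌉₊ + 2)) * sig

theorem gridPoint_succ (lam sig : ℝ) (i : ℕ) :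
    gridPoint lam sig (i + 1) = gridPoint lam sig i + sig := by
  simp only [gridPoint]; push_cast; ring

theorem gridPoint_mono {lam sig : ℝ} (hsig : 0 < sig) : Monotone (gridPoint lam sig) :=
  monotone_nat_of_le_succ fun i => by rw [gridPoint_succ]; linarith

theorem gridPoint_mem {lam sig : ℝ} (hls : 0 ≤ lam / sig) {i : ℕ} (hi : i ≤ numGaps lam sig) :
    gridPoint lam sig i ∈ searchGrid lam sig := by
  refine ⟨(i : ℤ) - (⌈lam / sig⌉₊ + 2), ?_, by simp [gridPoint]⟩
  rw [← Int.natCast_ceil_eq_ceil hls, abs_le]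
  unfold numGaps at hi
  omega

/-- `T` rounds of the search for the level `0.495`, then `T` rounds of the search for the level
`0.505`. -/
noncomputable def medianSearch (lam sig : ℝ) (T : ℕ) : OneBitProtocol (ℝ × ℝ) where
  n := 2 * T + 2 * T
  Seed := Unit
  seedSpace := inferInstance
  law := Measure.dirac ()
  isProb := inferInstance
  query _ h := Set.Iic (gridPoint lam sig (if h.length < 2 * T then
    (searchState 0.495 (numGaps lam sig) h).point
    else (searchState 0.505 (numGaps lam sig) (h.drop (2 * T))).point))
  output _ h := (gridPoint lam sig (searchResult 0.495 (numGaps lam sig) (h.take (2 * T))),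
    gridPoint lam sig (searchResult 0.505 (numGaps lam sig) (h.drop (2 * T)) + 1))
  measurableSet_query _ := measurable_snd measurableSet_Iic
  measurable_output _ := measurable_const

open Classical in
theorem medianSearch_prob (lam sig : ℝ) (T : ℕ) (D : Measure ℝ) [IsProbabilityMeasure D]
    {S : Set (ℝ × ℝ)} (hS : MeasurableSet S) :
    (medianSearch lam sig T).prob D S =
      expect (fun h => cdf D (gridPoint lam sig (if h.length < 2 * T then
        (searchState 0.495 (numGaps lam sig) h).point
        else (searchState 0.505 (numGaps lam sig) (h.drop (2 * T))).point)))
      (2 * T + 2 * T) (fun h => if (medianSearch lam sig T).output () h ∈ S then 1 else 0) [] := by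
  have h1 := (medianSearch lam sig T).measurable_run hS
  have h2 := pi_real_answers_mem D (2 * T + 2 * T)
    (q := (medianSearch lam sig T).query ()) (fun h => measurableSet_Iic)
    {h | (medianSearch lam sig T).output () h ∈ S}
  have h3 : ∀ E : Set (Unit × (Fin (2 * T + 2 * T) → ℝ)), MeasurableSet E →
      ((Measure.dirac ()).prod (Measure.pi fun _ : Fin (2 * T + 2 * T) => D)).real E =
        (Measure.pi fun _ : Fin (2 * T + 2 * T) => D).real (Prod.mk () ⁻¹' E) := by
    intro E hE
    rw [measureReal_def, Measure.dirac_prod, Measure.map_apply measurable_prodMk_left hE,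
      measureReal_def]
  refine (h3 _ h1).trans (Eq.trans h2 ?_)
  simp only [medianSearch, cdf_eq_real]
  rfl

theorem measurableSet_setOf_lower (D : Measure ℝ) (sig : ℝ) {a b : ℝ} (hab : a < b)
    (hsig : 0 < sig) : MeasurableSet {z : ℝ × ℝ |
      (Set.Icc (cdf D z.1) (cdf D (z.1 + sig)) ∩ Set.Ioo a b).Nonempty} := by
  have h1 : Measurable (cdf D) := (monotone_cdf D).measurable
  have h2 : ∀ z : ℝ × ℝ, cdf D z.1 ≤ cdf D (z.1 + sig) := fun z => monotone_cdf D (by linarith)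
  simp only [Icc_inter_Ioo_nonempty_iff hab (h2 _)]
  exact (measurableSet_lt (h1.comp measurable_fst) measurable_const).inter
    (measurableSet_lt measurable_const (h1.comp (measurable_fst.add_const sig)))

theorem measurableSet_setOf_upper (D : Measure ℝ) (sig : ℝ) {a b : ℝ} (hab : a < b)
    (hsig : 0 < sig) : MeasurableSet {z : ℝ × ℝ |
      (Set.Icc (cdf D (z.2 - sig)) (cdf D z.2) ∩ Set.Ioo a b).Nonempty} := by
  have h1 : Measurable (cdf D) := (monotone_cdf D).measurable
  have h2 : ∀ z : ℝ × ℝ, cdf D (z.2 - sig) ≤ cdf D z.2 := fun z => monotone_cdf D (by linarith)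
  simp only [Icc_inter_Ioo_nonempty_iff hab (h2 _)]
  exact (measurableSet_lt (h1.comp (measurable_snd.sub_const sig)) measurable_const).inter
    (measurableSet_lt measurable_const (h1.comp measurable_snd))

open Classical in
/-- The search among the grid points misses the level `τ` with exponentially small probability. -/
theorem expect_gridSearch_notMem_le {lam sig : ℝ} (hsig : 0 < sig) {D : Measure ℝ}
    (hD : D ∈ meanVarFamily lam sig) {τ : ℝ} (hτ : τ ∈ Set.Icc (0.49 : ℝ) 0.51) (T : ℕ) :
    expect (fun h => cdf D (gridPoint lam sig (searchState τ (numGaps lam sig) h).point)) (2 * T)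
      (fun h => if searchResult τ (numGaps lam sig) h ∈
        crossingGaps (fun i => cdf D (gridPoint lam sig i)) τ then 0 else 1) [] ≤
      numGaps lam sig * Real.exp (-(8e-8 * T)) := by
  have hceil : lam ≤ ⌈lam / sig⌉₊ * sig := by
    rw [← div_le_iff₀ hsig]
    exact Nat.le_ceil _
  have hmean := hD.2.2.1
  refine expect_searchResult_notMem_le (p := fun i => cdf D (gridPoint lam sig i)) hτ
    (fun i => ⟨cdf_nonneg _ _, cdf_le_one _ _⟩) ((monotone_cdf D).comp (gridPoint_mono hsig))
    ?_ ?_ (fun _ => rfl) T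
  · refine (cdf_le_of_add_le_mean hsig hD (t := 2) (by norm_num) ?_).trans_lt
      (by norm_num; linarith [hτ.1])
    simp only [gridPoint]
    push_cast
    nlinarith [hmean.1]
  · refine le_trans (by norm_num; linarith [hτ.2])
      (le_cdf_of_mean_add_le hsig hD (t := 2) (by norm_num) ?_)
    simp only [gridPoint, numGaps]
    push_cast
    nlinarith [hmean.2]

theorem medianSearch_isNoisyMedianSearch {lam sig η : ℝ} (hsig : 0 < sig) (hls : sig ≤ lam)
    {T : ℕ} (hT : numGaps lam sig * Real.exp (-(8e-8 * T)) ≤ η) :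
    IsNoisyMedianSearch (medianSearch lam sig T) lam sig η := by
  classical
  have hls' : 0 ≤ lam / sig := div_nonneg (by linarith) hsig.le
  have hN : 0 < numGaps lam sig := by unfold numGaps; omega
  have hpt : ∀ (τ : ℝ) (h : List Bool),
      (searchState τ (numGaps lam sig) h).point ≤ numGaps lam sig := by
    intro τ h
    have h1 := searchState_gap_lt (τ := τ) hN h
    have h2 := Bool.toNat_le (searchState τ (numGaps lam sig) h).second
    rw [SearchState.point]
    omega
  have hres : ∀ (τ : ℝ) (h : List Bool), searchResult τ (numGaps lam sig) h < numGaps lam sig :=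
    fun τ h => weightedMedian_lt hN
  refine ⟨fun ω h => ⟨_, gridPoint_mem hls' ?_, rfl⟩,
    fun ω h => ⟨gridPoint_mem hls' (hres _ _).le, gridPoint_mem hls' (hres _ _)⟩,
    fun D hD => ?_, fun D hD => ?_⟩
  · split_ifs
    · exact hpt _ _
    · exact hpt _ _
  · have := hD.1
    rw [medianSearch_prob lam sig T D (measurableSet_setOf_lower D sig (by norm_num) hsig)]
    set r : List Bool → ℝ := fun h => cdf D (gridPoint lam sig (if h.length < 2 * T then
        (searchState 0.495 (numGaps lam sig) h).point
        else (searchState 0.505 (numGaps lam sig) (h.drop (2 * T))).point)) with hr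
    have hr01 : ∀ h, r h ∈ Set.Icc (0 : ℝ) 1 := fun h => ⟨cdf_nonneg _ _, cdf_le_one _ _⟩
    let bad : List Bool → ℝ := fun h => if searchResult 0.495 (numGaps lam sig) h ∈
        crossingGaps (fun i => cdf D (gridPoint lam sig i)) 0.495 then 0 else 1
    have hsearch : expect r (2 * T) bad [] ≤ η := by
      rw [expect_congr_prob (r' := fun h => cdf D (gridPoint lam sig
        (searchState 0.495 (numGaps lam sig) h).point)) _ _ _ fun l hl => by
          simp only [List.nil_append, hr, if_pos hl]]
      exact (expect_gridSearch_notMem_le hsig hD (by norm_num) T).trans hT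
    have hbad : expect r (2 * T + 2 * T) (fun h => bad (h.take (2 * T))) [] ≤ η := by
      rw [expect_add]
      refine (expect_mono hr01 _ _ fun l hl => ?_).trans hsearch
      rw [List.nil_append, ← expect_const (r := r) (bad l) (2 * T) l]
      refine expect_mono hr01 _ _ fun l' _ => ?_
      rw [List.take_left' hl]
    refine le_trans ?_
      (expect_mono hr01 (f := fun h => 1 - bad (h.take (2 * T))) _ _ fun l hl => ?_)
    · rw [expect_one_sub]
      linarith
    · simp only [List.nil_append, bad]
      by_cases hc : searchResult 0.495 (numGaps lam sig) (l.take (2 * T)) ∈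
        crossingGaps (fun i => cdf D (gridPoint lam sig i)) 0.495
      · rw [if_pos hc, if_pos]
        · norm_num
        · rw [Set.mem_ofPred_eq, Icc_inter_Ioo_nonempty_iff (by norm_num)
            (monotone_cdf D (by linarith))]
          simp only [medianSearch, ← gridPoint_succ]
          obtain ⟨h1, h2⟩ := hc
          norm_num at h1 h2 ⊢
          exact ⟨h1, h2⟩
      · rw [if_neg hc]
        split_ifs <;> norm_num
  · have := hD.1
    rw [medianSearch_prob lam sig T D (measurableSet_setOf_upper D sig (by norm_num) hsig)]
    set r : List Bool → ℝ := fun h => cdf D (gridPoint lam sig (if h.length < 2 * T then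
        (searchState 0.495 (numGaps lam sig) h).point
        else (searchState 0.505 (numGaps lam sig) (h.drop (2 * T))).point)) with hr
    have hr01 : ∀ h, r h ∈ Set.Icc (0 : ℝ) 1 := fun h => ⟨cdf_nonneg _ _, cdf_le_one _ _⟩
    let bad : List Bool → ℝ := fun h => if searchResult 0.505 (numGaps lam sig) h ∈
        crossingGaps (fun i => cdf D (gridPoint lam sig i)) 0.505 then 0 else 1
    have hbad : expect r (2 * T + 2 * T) (fun h => bad (h.drop (2 * T))) [] ≤ η := by
      rw [expect_add]
      refine (expect_mono hr01 _ _ fun l hl => ?_).trans_eq (expect_const η (2 * T) [])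
      have h1 := expect_append (r := r) (2 * T) (fun h => bad (h.drop (2 * T))) l []
      rw [List.append_nil] at h1
      simp only [List.drop_left' hl] at h1
      rw [List.nil_append, h1]
      have h2 : (fun g => r (l ++ g)) = fun g => cdf D (gridPoint lam sig
          (searchState 0.505 (numGaps lam sig) g).point) := by
        funext g
        simp only [hr]
        rw [if_neg (by simp [hl]), List.drop_left' hl]
      rw [h2]
      exact (expect_gridSearch_notMem_le hsig hD (by norm_num) T).trans hT
    refine le_trans ?_
      (expect_mono hr01 (f := fun h => 1 - bad (h.drop (2 * T))) _ _ fun l hl => ?_)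
    · rw [expect_one_sub]
      linarith
    · simp only [List.nil_append, bad]
      by_cases hc : searchResult 0.505 (numGaps lam sig) (l.drop (2 * T)) ∈
        crossingGaps (fun i => cdf D (gridPoint lam sig i)) 0.505
      · rw [if_pos hc, if_pos]
        · norm_num
        · rw [Set.mem_ofPred_eq, Icc_inter_Ioo_nonempty_iff (by norm_num)
            (monotone_cdf D (by linarith))]
          simp only [medianSearch, gridPoint_succ, add_sub_cancel_right]
          obtain ⟨h1, h2⟩ := hc
          simp only [gridPoint_succ] at h2
          norm_num at h1 h2 ⊢
          exact ⟨h1, h2⟩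
      · rw [if_neg hc]
        split_ifs <;> norm_num

/-! ### Centring and truncation -/

theorem abs_midpoint_sub_mean_le {lam sig : ℝ} (hsig : 0 < sig) {D : Measure ℝ}
    (hD : D ∈ meanVarFamily lam sig) {z : ℝ × ℝ}
    (hL : (Set.Icc (cdf D z.1) (cdf D (z.1 + sig)) ∩ Set.Ioo (0.49 : ℝ) 0.5).Nonempty)
    (hU : (Set.Icc (cdf D (z.2 - sig)) (cdf D z.2) ∩ Set.Ioo (0.5 : ℝ) 0.51).Nonempty) :
    |(z.1 + z.2) / 2 - ∫ y, y ∂D| ≤ 3 * sig := by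
  rw [Icc_inter_Ioo_nonempty_iff (by norm_num) (monotone_cdf D (by linarith))] at hL hU
  -- By Chebyshev's inequality the distribution function is below `4/9` and above `5/9` at distance
  -- `1.5 * sig` from the mean.
  have hlo : ∀ x, 0.49 < cdf D x → ∫ y, y ∂D - 1.5 * sig < x := by
    intro x hx
    by_contra! h
    have := cdf_le_of_add_le_mean hsig hD (t := 1.5) (x := x) (by norm_num) (by linarith)
    norm_num at this hx
    linarith
  have hhi : ∀ x, cdf D x < 0.51 → x < ∫ y, y ∂D + 1.5 * sig := by
    intro x hx
    by_contra! h
    have := le_cdf_of_mean_add_le hsig hD (t := 1.5) (x := x) (by norm_num) (by linarith)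
    norm_num at this hx
    linarith
  have h1 := hlo _ hL.2
  have h2 := hhi _ (hL.1.trans (by norm_num))
  have h3 := hlo _ (lt_trans (by norm_num) hU.2)
  have h4 := hhi _ hU.1
  rw [abs_le]
  constructor <;> linarith

theorem mSeq_succ_of_four_le {i : ℕ} (hi : 4 ≤ i) : mSeq (i + 1) = 2 * (mSeq i - 3) := by
  rw [mSeq, if_neg (by omega)]

theorem mSeq_eq_of_four_le {i : ℕ} (hi : 4 ≤ i) : mSeq i = 6 + 5 / 8 * 2 ^ i := by
  induction i, hi using Nat.le_induction with
  | base => norm_num [mSeq]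
  | succ i hi ih => rw [mSeq_succ_of_four_le hi, ih]; ring

theorem mSeq_strictMono : StrictMono mSeq := strictMono_nat_of_lt_succ mSeq_lt_succ

theorem mSeq_nonneg (i : ℕ) : 0 ≤ mSeq i := mSeq_strictMono.monotone (Nat.zero_le i)

theorem mSeq_le_two_pow (i : ℕ) : mSeq i ≤ 2 ^ i := by
  induction i with
  | zero => norm_num [mSeq]
  | succ i ih =>
    rw [mSeq]
    split_ifs
    · exact le_rfl
    · rw [pow_succ]; linarith

theorem iMax_spec {sig ε : ℝ} (hsig : 0 < sig) (hε : 0 < ε) :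
    5 ≤ iMax sig ε ∧ ((1 : ℝ) / 2) ^ iMax sig ε ≤ 5 * ε / (128 * sig) := by
  obtain ⟨n, hn⟩ := exists_pow_lt_of_lt_one (show 0 < 5 * ε / (128 * sig) by positivity)
    (show (1 : ℝ) / 2 < 1 by norm_num)
  have hne : {i : ℕ | 5 ≤ i ∧ ((1 : ℝ) / 2) ^ i ≤ 5 * ε / (128 * sig)}.Nonempty :=
    ⟨max 5 n, le_max_left _ _, (pow_le_pow_of_le_one (by norm_num) (by norm_num)
      (le_max_right _ _)).trans hn.le⟩
  exact Nat.sInf_mem hne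

open Classical in
theorem sum_Ico_indicator {a : ℕ → ℝ} (ha : Monotone a) (n : ℕ) (z : ℝ) :
    ∑ k : Fin n, (if z ∈ Set.Ico (a k) (a (k + 1)) then (1 : ℝ) else 0) =
      if z ∈ Set.Ico (a 0) (a n) then 1 else 0 := by
  induction n with
  | zero => simp
  | succ n ih =>
    have h1 := ha (Nat.zero_le n)
    have h2 := ha n.le_succ
    rw [Fin.sum_univ_castSucc]
    simp only [Fin.val_castSucc, Fin.val_last]
    rw [ih]
    simp only [Set.mem_Ico]
    by_cases h3 : z < a n
    · have : z < a (n + 1) := h3.trans_le h2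
      simp [h3, this, not_le.2 h3]
    · have h5 : a n ≤ z := not_lt.1 h3
      simp [h3, h5, h1.trans h5]

open Classical in
/-- The regions cover `(-sig * m, sig * m)`. The origin lies in two of them, which does no harm to a
sum of contributions `z`. -/
theorem sum_region_indicator_mul {sig : ℝ} (hsig : 0 < sig) (n : ℕ) (z : ℝ) :
    ∑ s : Bool, ∑ k : Fin n, (if z ∈ region sig s k then z else 0) =
      if |z| < sig * mSeq n then z else 0 := by
  have hmono : Monotone fun k => sig * mSeq k :=
    fun i j hij => mul_le_mul_of_nonneg_left (mSeq_strictMono.monotone hij) hsig.le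
  have hite : ∀ (P : Prop) [Decidable P],
      (if P then z else 0) = (if P then (1 : ℝ) else 0) * z := by
    intro P _
    split_ifs <;> simp
  have hpos := sum_Ico_indicator hmono n z
  have hneg := sum_Ico_indicator hmono n (-z)
  have htrue : ∀ k : Fin n, z ∈ region sig true k ↔
      z ∈ Set.Ico (sig * mSeq k) (sig * mSeq (k + 1)) := by
    intro k; simp [region, regionLo, regionHi]
  have hfalse : ∀ k : Fin n, z ∈ region sig false k ↔
      -z ∈ Set.Ico (sig * mSeq k) (sig * mSeq (k + 1)) := by
    intro k
    simp only [region, regionLo, regionHi, Bool.false_eq_true, if_false, Set.mem_Ioc, Set.mem_Ico]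
    constructor <;> rintro ⟨h1, h2⟩ <;> constructor <;> linarith
  rw [Fintype.sum_bool]
  simp only [hite, htrue, hfalse, ← Finset.sum_mul, hpos, hneg]
  have h0 : mSeq 0 = 0 := rfl
  simp only [h0, mul_zero, Set.mem_Ico]
  rcases lt_trichotomy z 0 with h | rfl | h
  · rw [abs_of_neg h]
    simp [h.not_ge, h.le]
  · simp
  · rw [abs_of_pos h]
    simp [h.not_ge, h.le]

/-- The part of the mean that lies outside the regions is negligible: far away from the centre,
`|x - c|` is at most a small multiple of the squared distance of `x` from the mean. -/
theorem integral_tail_le {lam sig : ℝ} (hsig : 0 < sig) {D : Measure ℝ}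
    (hD : D ∈ meanVarFamily lam sig) {c m : ℝ} (hc : |c - ∫ y, y ∂D| ≤ 3 * sig) (hm : 26 ≤ m) :
    |∫ x, (if |x - c| < sig * m then x - c else 0) ∂D - (∫ y, y ∂D - c)| ≤ 2 * sig / m := by
  obtain ⟨hprob, hL2, -, hvar⟩ := hD
  set μ := ∫ y, y ∂D with hμ
  have hint : Integrable (fun x : ℝ => x) D := hL2.integrable one_le_two
  have hint' : Integrable (fun x : ℝ => x - c) D := hint.sub (integrable_const c)
  have hmeas : Measurable fun x : ℝ => if |x - c| < sig * m then x - c else 0 :=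
    Measurable.ite (measurableSet_lt (by fun_prop) measurable_const) (by fun_prop)
      measurable_const
  have hint1 : Integrable (fun x : ℝ => if |x - c| < sig * m then x - c else 0) D := by
    refine hint'.mono hmeas.aestronglyMeasurable (Filter.Eventually.of_forall fun x => ?_)
    split_ifs
    · exact le_rfl
    · simp
  have hsq : Integrable (fun x : ℝ => (x - μ) ^ 2) D :=
    (hL2.sub (memLp_const μ)).integrable_sq
  have hmean : ∫ x, (x - c) ∂D = μ - c := by
    rw [integral_sub hint (integrable_const c)]
    simp [hμ]
  rw [← hmean, ← integral_sub hint1 hint', ← Real.norm_eq_abs]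
  refine (norm_integral_le_of_norm_le (g := fun x => 2 / (sig * m) * (x - μ) ^ 2)
    (hsq.const_mul _) (Filter.Eventually.of_forall fun x => ?_)).trans ?_
  · have h0 : 0 ≤ 2 / (sig * m) * (x - μ) ^ 2 := by positivity
    split_ifs with hx
    · simpa using h0
    · rw [not_lt] at hx
      rw [zero_sub, norm_neg, Real.norm_eq_abs, div_mul_eq_mul_div, le_div_iff₀ (by positivity)]
      have h1 : |x - c| ≤ |x - μ| + 3 * sig := by
        have := abs_sub_le x μ c
        rw [abs_sub_comm μ c] at this
        linarith
      have h2 : 26 * sig ≤ |x - c| := by nlinarith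
      have h3 : 23 / 26 * |x - c| ≤ |x - μ| := by linarith
      have h4 : (23 / 26 * |x - c|) ^ 2 ≤ (x - μ) ^ 2 := by
        rw [← sq_abs (x - μ)]
        exact pow_le_pow_left₀ (by positivity) h3 2
      nlinarith [mul_le_mul_of_nonneg_left hx (abs_nonneg (x - c)), sq_nonneg (x - c),
        sq_abs (x - c)]
  · rw [integral_const_mul]
    have h1 : ∫ x, (x - μ) ^ 2 ∂D ≤ sig ^ 2 := by
      rw [← variance_eq_integral hL2.aemeasurable]
      exact hvar
    calc 2 / (sig * m) * ∫ x, (x - μ) ^ 2 ∂D ≤ 2 / (sig * m) * sig ^ 2 := by gcongr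
      _ = 2 * sig / m := by field_simp

/-! ### Randomized interval queries -/

theorem unifLaw_real_eq {a b : ℝ} (hab : a < b) (S : Set ℝ) :
    (unifLaw a b).real S = (b - a)⁻¹ * volume.real (Set.Ioo a b ∩ S) := by
  rw [unifLaw, measureReal_def, cond_apply measurableSet_Ioo, ENNReal.toReal_mul,
    ENNReal.toReal_inv, ← measureReal_def, ← measureReal_def, Real.volume_real_Ioo_of_le hab.le]

theorem unifLaw_real_Ici {a b z : ℝ} (hab : a < b) (hz : z ∈ Set.Icc a b) :
    (unifLaw a b).real {T | z ≤ T} = (b - z) / (b - a) := by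
  have h1 : volume.real (Set.Ioo a b ∩ {T | z ≤ T}) = b - z := by
    refine le_antisymm ?_ ?_
    · rw [← Real.volume_real_Icc_of_le hz.2]
      exact measureReal_mono (fun T hT => ⟨hT.2, hT.1.2.le⟩)
        (by rw [Real.volume_Icc]; exact ENNReal.ofReal_ne_top)
    · rw [← Real.volume_real_Ioo_of_le hz.2]
      exact measureReal_mono (fun T hT => ⟨⟨hz.1.trans_lt hT.1, hT.2⟩, hT.1.le⟩)
        ((measure_mono Set.inter_subset_left).trans_lt (by simp)).ne
  rw [unifLaw_real_eq hab, h1]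
  ring

theorem unifLaw_real_Iic {a b z : ℝ} (hab : a < b) (hz : z ∈ Set.Icc a b) :
    (unifLaw a b).real {T | T ≤ z} = (z - a) / (b - a) := by
  have h1 : volume.real (Set.Ioo a b ∩ {T | T ≤ z}) = z - a := by
    refine le_antisymm ?_ ?_
    · rw [← Real.volume_real_Icc_of_le hz.1]
      exact measureReal_mono (fun T hT => ⟨hT.1.1.le, hT.2⟩)
        (by rw [Real.volume_Icc]; exact ENNReal.ofReal_ne_top)
    · rw [← Real.volume_real_Ioo_of_le hz.1]
      exact measureReal_mono (fun T hT => ⟨⟨hT.1, hT.2.trans_le hz.2⟩, hT.2.le⟩)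
        ((measure_mono Set.inter_subset_left).trans_lt (by simp)).ne
  rw [unifLaw_real_eq hab, h1]
  ring

/-- Pairs of a random end point and a sample for which the answer to the randomized interval query
is positive. -/
def querySet (sig c : ℝ) (s : Bool) (k : ℕ) (side : Bool) : Set (ℝ × ℝ) :=
  {y | y.2 ∈ regionQuery sig c s k side y.1}

/-- The probability of a positive answer to a randomized interval query. -/
noncomputable def queryProb (D : Measure ℝ) (sig c : ℝ) (s : Bool) (k : ℕ) (side : Bool) : ℝ :=
  ((unifLaw (regionLo sig s k) (regionHi sig s k)).prod D).real (querySet sig c s k side)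

theorem measurableSet_querySet (sig c : ℝ) (s : Bool) (k : ℕ) (side : Bool) :
    MeasurableSet (querySet sig c s k side) := by
  have h1 : Measurable fun y : ℝ × ℝ => y.2 - c := by fun_prop
  refine MeasurableSet.inter (h1 (measurableSet_region sig s k)) ?_
  cases side
  · exact measurableSet_le h1 measurable_fst
  · exact measurableSet_le measurable_fst h1

theorem region_subset_Icc (sig : ℝ) (s : Bool) (k : ℕ) :
    region sig s k ⊆ Set.Icc (regionLo sig s k) (regionHi sig s k) := by
  cases s
  · exact Set.Ioc_subset_Icc_self
  · exact Set.Ico_subset_Icc_self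

open Classical in
theorem queryProb_eq_integral {sig : ℝ} (hsig : 0 < sig) (D : Measure ℝ) [IsProbabilityMeasure D]
    (c : ℝ) (s : Bool) (k : ℕ) (side : Bool) :
    queryProb D sig c s k side = ∫ x, (if x - c ∈ region sig s k then
      (if side then x - c - regionLo sig s k else regionHi sig s k - (x - c)) /
        (regionHi sig s k - regionLo sig s k) else 0) ∂D := by
  have hab := regionLo_lt_regionHi hsig s k
  have := isProbabilityMeasure_unifLaw hab
  have hmeas := measurableSet_querySet sig c s k side
  rw [queryProb, measureReal_def, Measure.prod_apply_symm hmeas, ← integral_toReal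
    (measurable_measure_prodMk_right hmeas).aemeasurable
    (Filter.Eventually.of_forall fun x => measure_lt_top _ _)]
  refine integral_congr_ae (Filter.Eventually.of_forall fun x => ?_)
  simp only []
  rw [← measureReal_def]
  by_cases hx : x - c ∈ region sig s k
  · rw [if_pos hx]
    have hx' := region_subset_Icc sig s k hx
    have h1 : (fun T => (T, x)) ⁻¹' querySet sig c s k side =
        {T | if side then T ≤ x - c else x - c ≤ T} := by
      ext T
      simp [querySet, regionQuery, hx]
    rw [h1]
    cases side
    · simpa using unifLaw_real_Ici hab hx'
    · simpa using unifLaw_real_Iic hab hx'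
  · rw [if_neg hx]
    have h1 : (fun T => (T, x)) ⁻¹' querySet sig c s k side = ∅ := by
      ext T
      simp [querySet, regionQuery, hx]
    simp [h1]

open Classical in
/-- The two query probabilities of a region determine its contribution to the mean: a point `z` of
`[a, b]` is the mixture of `a` and `b` with the weights `P(z ≤ T)` and `P(T ≤ z)`. -/
theorem regionLo_mul_add_regionHi_mul {sig : ℝ} (hsig : 0 < sig) (D : Measure ℝ)
    [IsProbabilityMeasure D] (c : ℝ) (s : Bool) (k : ℕ) :
    regionLo sig s k * queryProb D sig c s k false + regionHi sig s k * queryProb D sig c s k true =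
      ∫ x, (if x - c ∈ region sig s k then x - c else 0) ∂D := by
  have hab := regionLo_lt_regionHi hsig s k
  have hint : ∀ side : Bool, Integrable (fun x => if x - c ∈ region sig s k then
      (if side then x - c - regionLo sig s k else regionHi sig s k - (x - c)) /
        (regionHi sig s k - regionLo sig s k) else 0) D := by
    intro side
    refine Integrable.of_bound (C := 1) (Measurable.aestronglyMeasurable ?_)
      (Filter.Eventually.of_forall fun x => ?_)
    · refine Measurable.ite ?_ ?_ measurable_const
      · exact (measurable_id.sub_const c) (measurableSet_region sig s k)
      · cases side <;> simp <;> fun_prop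
    · split_ifs with hx hs
      · have := region_subset_Icc sig s k hx
        rw [Real.norm_eq_abs, abs_of_nonneg (div_nonneg (by linarith [this.1]) (by linarith)),
          div_le_one (by linarith)]
        linarith [this.2]
      · have := region_subset_Icc sig s k hx
        rw [Real.norm_eq_abs, abs_of_nonneg (div_nonneg (by linarith [this.2]) (by linarith)),
          div_le_one (by linarith)]
        linarith [this.1]
      · simp
  rw [queryProb_eq_integral hsig, queryProb_eq_integral hsig, ← integral_const_mul,
    ← integral_const_mul, ← integral_add ((hint false).const_mul _) ((hint true).const_mul _)]
  refine integral_congr_ae (Filter.Eventually.of_forall fun x => ?_)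
  have : regionHi sig s k - regionLo sig s k ≠ 0 := by linarith
  simp only [Bool.false_eq_true, if_false, if_true]
  split_ifs
  · field_simp
    ring
  · simp

/-- The regions far away from the centre have small probabilities, so that their query
probabilities are estimated from fewer samples. -/
theorem queryProb_le {lam sig : ℝ} (hsig : 0 < sig) {D : Measure ℝ}
    (hD : D ∈ meanVarFamily lam sig) {c : ℝ} (hc : |c - ∫ y, y ∂D| ≤ 3 * sig) {k : ℕ} (hk : 4 ≤ k)
    (s side : Bool) : queryProb D sig c s k side ≤ 4 / mSeq (k + 1) ^ 2 := by
  have := hD.1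
  have := isProbabilityMeasure_unifLaw (regionLo_lt_regionHi hsig s k)
  have hm : 16 ≤ mSeq k := (mSeq_lt_succ_aux k).2 hk
  have hsub : querySet sig c s k side ⊆
      Set.univ ×ˢ {x | (mSeq k - 3) * sig ≤ |x - ∫ y, y ∂D|} := by
    rintro ⟨T, x⟩ hx
    refine ⟨Set.mem_univ _, ?_⟩
    have h1 := region_subset_Icc sig s k hx.1
    have h2 : sig * mSeq k ≤ |x - c| := by
      cases s
      · simp only [regionHi, Bool.false_eq_true, if_false, Set.mem_Icc] at h1
        exact le_trans (by linarith) (neg_le_abs _)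
      · simp only [regionLo, if_true, Set.mem_Icc] at h1
        exact le_trans (by linarith) (le_abs_self _)
    have h3 := abs_sub_le x (∫ y, y ∂D) c
    rw [abs_sub_comm (∫ y, y ∂D) c] at h3
    rw [Set.mem_ofPred_eq]
    dsimp only
    linarith
  calc queryProb D sig c s k side ≤ ((unifLaw (regionLo sig s k) (regionHi sig s k)).prod D).real
        (Set.univ ×ˢ {x | (mSeq k - 3) * sig ≤ |x - ∫ y, y ∂D|}) := measureReal_mono hsub
    _ = D.real {x | (mSeq k - 3) * sig ≤ |x - ∫ y, y ∂D|} := by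
        rw [measureReal_prod_prod, probReal_univ, one_mul]
    _ ≤ 1 / (mSeq k - 3) ^ 2 := real_le_abs_sub_mean_le hsig hD (by linarith)
    _ = 4 / mSeq (k + 1) ^ 2 := by
        have : mSeq k - 3 ≠ 0 := by linarith
        rw [mSeq_succ_of_four_le hk]
        field_simp
        norm_num

/-- The estimator would be accurate if the query probabilities were known exactly. -/
theorem abs_sum_queryProb_sub_mean_le {lam sig ε : ℝ} (hsig : 0 < sig) (hε : 0 < ε) {D : Measure ℝ}
    (hD : D ∈ meanVarFamily lam sig) {c : ℝ} (hc : |c - ∫ y, y ∂D| ≤ 3 * sig) :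
    |c + ∑ s : Bool, ∑ k : Fin (iMax sig ε),
      (regionLo sig s k * queryProb D sig c s k false +
        regionHi sig s k * queryProb D sig c s k true) - ∫ y, y ∂D| ≤ ε / 2 := by
  classical
  have hprob := hD.1
  obtain ⟨h5, hpow⟩ := iMax_spec hsig hε
  have hint : Integrable (fun x : ℝ => x - c) D :=
    (hD.2.1.integrable one_le_two).sub (integrable_const c)
  have hint' : ∀ (s : Bool) (k : Fin (iMax sig ε)),
      Integrable (fun x => if x - c ∈ region sig s k then x - c else 0) D := by
    intro s k
    refine hint.mono (Measurable.aestronglyMeasurable ?_)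
      (Filter.Eventually.of_forall fun x => ?_)
    · exact Measurable.ite ((measurable_id.sub_const c) (measurableSet_region sig s k))
        (by fun_prop) measurable_const
    · split_ifs
      · exact le_rfl
      · simp
  have hsum : ∑ s : Bool, ∑ k : Fin (iMax sig ε),
      (regionLo sig s k * queryProb D sig c s k false +
        regionHi sig s k * queryProb D sig c s k true) =
      ∫ x, (if |x - c| < sig * mSeq (iMax sig ε) then x - c else 0) ∂D := by
    simp only [regionLo_mul_add_regionHi_mul hsig, ← sum_region_indicator_mul hsig]
    rw [integral_finsetSum _ fun s _ => integrable_finsetSum _ fun k _ => hint' s k]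
    exact Finset.sum_congr rfl fun s _ => (integral_finsetSum _ fun k _ => hint' s k).symm
  have hm : mSeq (iMax sig ε) = 6 + 5 / 8 * 2 ^ iMax sig ε := mSeq_eq_of_four_le (by omega)
  have h32 : (2 : ℝ) ^ 5 ≤ 2 ^ iMax sig ε := pow_le_pow_right₀ one_le_two h5
  have htail := integral_tail_le hsig hD hc (m := mSeq (iMax sig ε)) (by rw [hm]; linarith)
  rw [hsum, show ∀ I μ : ℝ, c + I - μ = I - (μ - c) by intros; ring]
  refine htail.trans ?_
  rw [one_div, inv_pow, inv_le_comm₀ (by positivity) (by positivity), inv_div,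
    div_le_iff₀ (by positivity)] at hpow
  rw [hm, div_le_iff₀ (by positivity)]
  nlinarith

/-! ### Deviations of empirical frequencies -/

section Concentration

variable {Ω : Type*} [MeasurableSpace Ω] {μ : Measure Ω} [IsProbabilityMeasure μ]

theorem mgf_indicator_one {B : Set Ω} (hB : MeasurableSet B) (t : ℝ) :
    mgf (B.indicator (1 : Ω → ℝ)) μ t = 1 + μ.real B * (Real.exp t - 1) := by
  have h1 : (fun ω => Real.exp (t * B.indicator (1 : Ω → ℝ) ω)) =
      fun ω => 1 + B.indicator (fun _ => Real.exp t - 1) ω := by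
    funext ω
    by_cases h : ω ∈ B <;> simp [h]
  rw [mgf, h1, integral_add (integrable_const _) ((integrable_const _).indicator hB),
    integral_indicator_const _ hB]
  simp

theorem integrable_exp_mul_sum_indicator {n : ℕ} {B : Fin n → Set Ω}
    (hB : ∀ r, MeasurableSet (B r)) (t : ℝ) :
    Integrable (fun ω => Real.exp (t * (∑ r, (B r).indicator (1 : Ω → ℝ)) ω)) μ := by
  have hm : ∀ r, Measurable ((B r).indicator (1 : Ω → ℝ)) := fun r =>
    measurable_one.indicator (hB r)
  have hm' : Measurable (∑ r, (B r).indicator (1 : Ω → ℝ)) := by fun_prop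
  refine Integrable.of_bound (C := Real.exp (|t| * n))
    (Real.measurable_exp.comp (hm'.const_mul t)).aestronglyMeasurable
    (Filter.Eventually.of_forall fun ω => ?_)
  rw [Real.norm_eq_abs, Real.abs_exp, Real.exp_le_exp]
  refine (le_abs_self _).trans ?_
  rw [abs_mul]
  refine mul_le_mul_of_nonneg_left ?_ (abs_nonneg t)
  have h0 : ∀ r, 0 ≤ (B r).indicator (1 : Ω → ℝ) ω := fun r =>
    Set.indicator_nonneg (fun _ _ => zero_le_one) ω
  rw [Finset.sum_apply, abs_of_nonneg (Finset.sum_nonneg fun r _ => h0 r)]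
  refine (Finset.sum_le_card_nsmul _ _ 1 fun r _ => ?_).trans (by simp)
  exact Set.indicator_le_self' (fun _ _ => zero_le_one) ω

/-- Chernoff's bound for the frequency of independent events of probability `p`. -/
theorem real_lt_abs_freq_sub_le {n : ℕ} (hn : 0 < n) {B : Fin n → Set Ω}
    (hB : ∀ r, MeasurableSet (B r))
    (hind : iIndepFun (fun r => (B r).indicator (1 : Ω → ℝ)) μ) {p : ℝ}
    (hp : ∀ r, μ.real (B r) = p) {s ψ : ℝ} (hs : 0 < s)
    (hψ : ∀ t, |t| = s → Real.exp (-(t * p)) * (1 + p * (Real.exp t - 1)) ≤ Real.exp ψ) (ε : ℝ) :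
    μ.real {ω | ε < |(∑ r, (B r).indicator (1 : Ω → ℝ) ω) / n - p|} ≤
      2 * Real.exp (-(n * (s * ε - ψ))) := by
  have hn' : (0 : ℝ) < n := Nat.cast_pos.2 hn
  have hm : ∀ r, Measurable ((B r).indicator (1 : Ω → ℝ)) := fun r =>
    measurable_one.indicator (hB r)
  set X : Ω → ℝ := ∑ r, (B r).indicator (1 : Ω → ℝ) with hX
  have hmgf : ∀ t, mgf X μ t = (1 + p * (Real.exp t - 1)) ^ n := by
    intro t
    rw [hX, hind.mgf_sum hm]
    simp [mgf_indicator_one (hB _), hp]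
  have hp01 : 0 ≤ p ∧ p ≤ 1 := by
    rw [← hp ⟨0, hn⟩]
    exact ⟨measureReal_nonneg, measureReal_le_one⟩
  have hfac : ∀ t, 0 ≤ 1 + p * (Real.exp t - 1) := fun t => by
    nlinarith [Real.exp_pos t]
  have hbound : ∀ t, |t| = s →
      Real.exp (-t * (n * (p + t / |t| * ε))) * mgf X μ t ≤ Real.exp (-(n * (s * ε - ψ))) := by
    intro t ht
    have h1 : t * (t / |t|) = s := by
      rcases eq_or_ne t 0 with rfl | h0
      · simpa using ht
      · rw [← mul_div_assoc, ← abs_mul_abs_self t, mul_div_assoc, div_self (abs_ne_zero.2 h0),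
          mul_one, ht]
    have h2 : Real.exp (-t * (n * (p + t / |t| * ε))) =
        Real.exp (-(n * (s * ε))) * Real.exp (-(t * p)) ^ n := by
      rw [← Real.exp_nat_mul, ← Real.exp_add, ← h1]
      ring_nf
    have h3 : Real.exp (-(n * (s * ε - ψ))) =
        Real.exp (-(n * (s * ε))) * Real.exp ψ ^ n := by
      rw [← Real.exp_nat_mul, ← Real.exp_add]
      ring_nf
    rw [h2, h3, hmgf, mul_assoc, ← mul_pow]
    exact mul_le_mul_of_nonneg_left (pow_le_pow_left₀ (mul_nonneg (Real.exp_pos _).le (hfac t))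
      (hψ t ht) n) (Real.exp_pos _).le
  have hup := (measure_ge_le_exp_mul_mgf (μ := μ) (X := X) (n * (p + ε)) hs.le
    (integrable_exp_mul_sum_indicator hB s)).trans (le_of_eq_of_le (by
      rw [abs_of_pos hs, div_self hs.ne', one_mul]) (hbound s (abs_of_pos hs)))
  have hdown := (measure_le_le_exp_mul_mgf (μ := μ) (X := X) (n * (p - ε)) (neg_nonpos.2 hs.le)
    (integrable_exp_mul_sum_indicator hB (-s))).trans (le_of_eq_of_le (by
      rw [abs_neg, abs_of_pos hs, neg_div, div_self hs.ne', neg_one_mul, ← sub_eq_add_neg])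
      (hbound (-s) (by rw [abs_neg, abs_of_pos hs])))
  refine (measureReal_mono (s₂ := {ω | n * (p + ε) ≤ X ω} ∪ {ω | X ω ≤ n * (p - ε)})
    fun ω hω => ?_).trans ((measureReal_union_le _ _).trans (by linarith))
  rw [Set.mem_ofPred_eq, ← Finset.sum_apply, ← hX, lt_abs] at hω
  rcases hω with h | h
  · left
    have : p + ε < X ω / n := by linarith
    rw [lt_div_iff₀ hn'] at this
    rw [Set.mem_ofPred_eq]
    linarith
  · right
    have : X ω / n < p - ε := by linarith
    rw [div_lt_iff₀ hn'] at this
    rw [Set.mem_ofPred_eq]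
    linarith

/-- Hoeffding's inequality for frequencies. -/
theorem real_lt_abs_freq_sub_le_of_hoeffding {n : ℕ} (hn : 0 < n) {B : Fin n → Set Ω}
    (hB : ∀ r, MeasurableSet (B r))
    (hind : iIndepFun (fun r => (B r).indicator (1 : Ω → ℝ)) μ) {p : ℝ}
    (hp : ∀ r, μ.real (B r) = p) {ε : ℝ} (hε : 0 < ε) :
    μ.real {ω | ε < |(∑ r, (B r).indicator (1 : Ω → ℝ) ω) / n - p|} ≤
      2 * Real.exp (-(n * (2 * ε ^ 2))) := by
  refine (real_lt_abs_freq_sub_le hn hB hind hp (s := 4 * ε) (ψ := 2 * ε ^ 2) (by linarith)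
    (fun t ht => ?_) ε).trans_eq (by ring_nf)
  have h1 := (hasSubgaussianMGF_of_mem_Icc (μ := μ) (a := 0) (b := 1)
    (X := (B ⟨0, hn⟩).indicator (1 : Ω → ℝ)) (measurable_one.indicator (hB _)).aemeasurable
    (Filter.Eventually.of_forall fun ω => by
      by_cases h : ω ∈ B ⟨0, hn⟩ <;> simp [h])).mgf_le t
  have h2 : ∫ ω, (B ⟨0, hn⟩).indicator (1 : Ω → ℝ) ω ∂μ = p := by
    rw [integral_indicator_one (hB _), hp]
  rw [h2] at h1
  have h3 : mgf (fun ω => (B ⟨0, hn⟩).indicator (1 : Ω → ℝ) ω - p) μ t =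
      Real.exp (-(t * p)) * (1 + p * (Real.exp t - 1)) := by
    simp only [sub_eq_add_neg]
    rw [mgf_add_const, mgf_indicator_one (hB _), hp]
    ring_nf
  rw [← h3]
  refine h1.trans_eq ?_
  rw [show (2 : ℝ) * ε ^ 2 = (4 * ε) ^ 2 / 8 by ring, ← ht, sq_abs]
  congr 1
  push_cast
  norm_num
  ring

theorem exp_sub_one_sub_self_le {t : ℝ} (ht : |t| < 3) :
    Real.exp t - 1 - t ≤ t ^ 2 / (2 * (1 - |t| / 3)) := by
  have h1 : HasSum (fun n : ℕ => t ^ (n + 2) / (n + 2).factorial) (Real.exp t - 1 - t) := by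
    have h := NormedSpace.expSeries_div_hasSum_exp (𝔸 := ℝ) t
    rw [← Real.exp_eq_exp_ℝ] at h
    rw [← hasSum_nat_add_iff' 2] at h
    simpa [Finset.sum_range_succ, sub_sub] using h
  have h2 : HasSum (fun n : ℕ => t ^ 2 / 2 * (|t| / 3) ^ n) (t ^ 2 / 2 * (1 - |t| / 3)⁻¹) :=
    (hasSum_geometric_of_lt_one (by positivity) (by linarith)).mul_left _
  refine (hasSum_le (fun n => ?_) h1 h2).trans_eq ?_
  · have h3 : (2 : ℝ) * 3 ^ n ≤ (n + 2).factorial := by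
      have := @Nat.factorial_mul_pow_le_factorial 2 n
      rw [add_comm n 2]
      exact_mod_cast this
    calc t ^ (n + 2) / (n + 2).factorial ≤ |t| ^ (n + 2) / (n + 2).factorial := by
          refine div_le_div_of_nonneg_right ?_ (by positivity)
          rw [← abs_pow]
          exact le_abs_self _
      _ ≤ |t| ^ (n + 2) / (2 * 3 ^ n) := by gcongr
      _ = t ^ 2 / 2 * (|t| / 3) ^ n := by
          rw [← sq_abs t, div_pow, pow_add]
          field_simp
  · have : 1 - |t| / 3 ≠ 0 := by linarith
    field_simp

/-- Bernstein's inequality for frequencies, with an upper bound `P` of the probability in the place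
of the variance. -/
theorem real_lt_abs_freq_sub_le_of_bernstein {n : ℕ} (hn : 0 < n) {B : Fin n → Set Ω}
    (hB : ∀ r, MeasurableSet (B r))
    (hind : iIndepFun (fun r => (B r).indicator (1 : Ω → ℝ)) μ) {p P : ℝ}
    (hp : ∀ r, μ.real (B r) = p) (hP : 0 < P) (hpP : p ≤ P) {ε : ℝ} (hε : 0 < ε) :
    μ.real {ω | ε < |(∑ r, (B r).indicator (1 : Ω → ℝ) ω) / n - p|} ≤
      2 * Real.exp (-(n * (ε ^ 2 / (2 * (P + ε / 3))))) := by
  have hp0 : 0 ≤ p := by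
    rw [← hp ⟨0, hn⟩]
    exact measureReal_nonneg
  have hs : 0 < ε / (P + ε / 3) := by positivity
  have hs3 : ε / (P + ε / 3) < 3 := by
    rw [div_lt_iff₀ (by positivity)]
    linarith
  -- This `s` minimizes the bound for the exponent.
  refine (real_lt_abs_freq_sub_le hn hB hind hp (s := ε / (P + ε / 3))
    (ψ := ε ^ 2 / (2 * (P + ε / 3))) hs (fun t ht => ?_) ε).trans_eq ?_
  · have h1 : p * (Real.exp t - 1 - t) ≤ ε ^ 2 / (2 * (P + ε / 3)) := by
      have h2 := exp_sub_one_sub_self_le (t := t) (by rwa [ht])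
      have h3 : 0 ≤ Real.exp t - 1 - t := by linarith [Real.add_one_le_exp t]
      rw [ht, ← sq_abs, ht] at h2
      calc p * (Real.exp t - 1 - t) ≤ P * (Real.exp t - 1 - t) := by gcongr
        _ ≤ P * ((ε / (P + ε / 3)) ^ 2 / (2 * (1 - ε / (P + ε / 3) / 3))) := by gcongr
        _ = ε ^ 2 / (2 * (P + ε / 3)) := by
            have : 1 - ε / (P + ε / 3) / 3 = P / (P + ε / 3) := by
              field_simp
              ring
            rw [this]
            field_simp
    calc Real.exp (-(t * p)) * (1 + p * (Real.exp t - 1))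
        ≤ Real.exp (-(t * p)) * Real.exp (p * (Real.exp t - 1)) := by
          gcongr
          rw [add_comm]
          exact Real.add_one_le_exp _
      _ = Real.exp (p * (Real.exp t - 1 - t)) := by
          rw [← Real.exp_add]
          ring_nf
      _ ≤ _ := Real.exp_le_exp.2 h1
  · congr 3
    field_simp
    ring

end Concentration

/-! ### Accuracy of the refinement -/

theorem epsRegion_pos {sig ε : ℝ} (hsig : 0 < sig) (hε : 0 < ε) (k : ℕ) :
    0 < epsRegion sig ε k := by
  have h1 : 0 < mSeq (k + 1) := (mSeq_nonneg k).trans_lt (mSeq_lt_succ k)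
  have h2 := mSeq_nonneg k
  have h3 : (0 : ℝ) < iMax sig ε := Nat.cast_pos.2 (by linarith [(iMax_spec hsig hε).1])
  unfold epsRegion
  positivity

theorem deltaRegion_mem {sig ε δ : ℝ} (hsig : 0 < sig) (hε : 0 < ε) (hδ : 0 < δ) (hδ1 : δ < 1) :
    deltaRegion sig ε δ ∈ Set.Ioo 0 1 := by
  have h3 : (5 : ℝ) ≤ iMax sig ε := by exact_mod_cast (iMax_spec hsig hε).1
  unfold deltaRegion
  constructor
  · positivity
  · rw [div_lt_one (by linarith)]
    linarith

theorem two_mul_exp_neg_le {n a δ : ℝ} (hδ : 0 < δ) (h : Real.log (2 / δ) ≤ n * a) :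
    2 * Real.exp (-(n * a)) ≤ δ := by
  calc 2 * Real.exp (-(n * a)) ≤ 2 * Real.exp (-Real.log (2 / δ)) := by gcongr
    _ = δ := by rw [Real.exp_neg, Real.exp_log (by positivity)]; field_simp

section Refinement

variable {lam sig ε δ : ℝ} (hsig : 0 < sig) (hε : 0 < ε) (hδ : 0 < δ) (hδ1 : δ < 1)

include hsig hε hδ hδ1

/-- The number of samples suffices for the accuracy `epsRegion`, by the inequalities of Hoeffding
and (for the regions of small probability) of Bernstein. -/
theorem real_lt_abs_freq_sub_queryProb_le {D : Measure ℝ} (hD : D ∈ meanVarFamily lam sig) {c : ℝ}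
    (hc : |c - ∫ y, y ∂D| ≤ 3 * sig) (s : Bool) (k : ℕ) (side : Bool)
    {Ω : Type*} [MeasurableSpace Ω] {μ : Measure Ω} [IsProbabilityMeasure μ]
    {B : Fin (nRegion sig ε δ k) → Set Ω} (hB : ∀ r, MeasurableSet (B r))
    (hind : iIndepFun (fun r => (B r).indicator (1 : Ω → ℝ)) μ)
    (hp : ∀ r, μ.real (B r) = queryProb D sig c s k side) :
    μ.real {ω | epsRegion sig ε k < |(∑ r, (B r).indicator (1 : Ω → ℝ) ω) / nRegion sig ε δ k -
      queryProb D sig c s k side|} ≤ deltaRegion sig ε δ := by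
  have hε' := epsRegion_pos hsig hε k
  obtain ⟨hδ', hδ1'⟩ := deltaRegion_mem hsig hε hδ hδ1
  have hlog : 0 < Real.log (2 / deltaRegion sig ε δ) :=
    Real.log_pos (by rw [lt_div_iff₀ hδ']; linarith)
  have hm : 0 < mSeq (k + 1) := (mSeq_nonneg k).trans_lt (mSeq_lt_succ k)
  have hn : 0 < nRegion sig ε δ k := by
    unfold nRegion
    split_ifs <;> exact Nat.ceil_pos.2 (by positivity)
  by_cases hk : k + 1 ≤ 4
  · refine (real_lt_abs_freq_sub_le_of_hoeffding hn hB hind hp hε').trans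
      (two_mul_exp_neg_le hδ' ?_)
    have h1 : 1 / (2 * epsRegion sig ε k ^ 2) * Real.log (2 / deltaRegion sig ε δ) ≤
        nRegion sig ε δ k := by
      rw [nRegion, if_pos hk]
      exact Nat.le_ceil _
    rwa [div_mul_eq_mul_div, one_mul, div_le_iff₀ (by positivity)] at h1
  · refine (real_lt_abs_freq_sub_le_of_bernstein hn hB hind hp (P := 4 / mSeq (k + 1) ^ 2)
      (by positivity) (queryProb_le hsig hD hc (by omega) s side) hε').trans
      (two_mul_exp_neg_le hδ' ?_)
    have h1 : (8 / mSeq (k + 1) ^ 2 * (1 / epsRegion sig ε k ^ 2) +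
        2 / 3 * (1 / epsRegion sig ε k)) * Real.log (2 / deltaRegion sig ε δ) ≤
        nRegion sig ε δ k := by
      rw [nRegion, if_neg hk]
      exact Nat.le_ceil _
    have h2 : 8 / mSeq (k + 1) ^ 2 * (1 / epsRegion sig ε k ^ 2) +
        2 / 3 * (1 / epsRegion sig ε k) =
        (epsRegion sig ε k ^ 2 / (2 * (4 / mSeq (k + 1) ^ 2 + epsRegion sig ε k / 3)))⁻¹ := by
      field_simp
      ring
    rw [h2, inv_mul_le_iff₀ (by positivity)] at h1
    rwa [mul_comm]

open Classical in
/-- The fraction of positive answers among the refinement queries of a region on a side, when the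
random end points and the samples are given by `y`. -/
noncomputable def refineFreq (sig ε δ c : ℝ) (s : Bool) (k : Fin (iMax sig ε)) (side : Bool)
    (y : RefineIdx sig ε δ → ℝ × ℝ) : ℝ :=
  (∑ r : Fin (nRegion sig ε δ k), if y ⟨s, k, side, r⟩ ∈ querySet sig c s k side then (1 : ℝ)
    else 0) / nRegion sig ε δ k

/-- The joint law of the random end points and the samples of all refinement queries. -/
noncomputable def refineLaw (sig ε δ : ℝ) (D : Measure ℝ) : Measure (RefineIdx sig ε δ → ℝ × ℝ) :=
  Measure.pi fun j => (unifLaw (regionLo sig j.1 j.2.1) (regionHi sig j.1 j.2.1)).prod D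

omit hε hδ hδ1 in
theorem isProbabilityMeasure_refineLaw (D : Measure ℝ) [IsProbabilityMeasure D] :
    IsProbabilityMeasure (refineLaw sig ε δ D) := by
  have : ∀ j : RefineIdx sig ε δ, IsProbabilityMeasure
      (unifLaw (regionLo sig j.1 j.2.1) (regionHi sig j.1 j.2.1)) := fun j =>
    isProbabilityMeasure_unifLaw (regionLo_lt_regionHi hsig _ _)
  unfold refineLaw
  infer_instance

theorem refineLaw_real_lt_abs_le {D : Measure ℝ} (hD : D ∈ meanVarFamily lam sig) {c : ℝ}
    (hc : |c - ∫ y, y ∂D| ≤ 3 * sig) (s : Bool) (k : Fin (iMax sig ε)) (side : Bool) :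
    (refineLaw sig ε δ D).real {y | epsRegion sig ε k <
      |refineFreq sig ε δ c s k side y - queryProb D sig c s k side|} ≤ deltaRegion sig ε δ := by
  have hD1 := hD.1
  have hU : ∀ j : RefineIdx sig ε δ, IsProbabilityMeasure
      (unifLaw (regionLo sig j.1 j.2.1) (regionHi sig j.1 j.2.1)) := fun j =>
    isProbabilityMeasure_unifLaw (regionLo_lt_regionHi hsig _ _)
  have := isProbabilityMeasure_refineLaw (ε := ε) (δ := δ) hsig D
  let e : Fin (nRegion sig ε δ k) → RefineIdx sig ε δ := fun r => ⟨s, k, side, r⟩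
  have he : Function.Injective e := fun r r' h => by simpa [e] using h
  let B : Fin (nRegion sig ε δ k) → Set (RefineIdx sig ε δ → ℝ × ℝ) := fun r =>
    (fun y => y (e r)) ⁻¹' querySet sig c s k side
  have hQ := measurableSet_querySet sig c s k side
  have hind : iIndepFun (fun r => (B r).indicator (1 : (RefineIdx sig ε δ → ℝ × ℝ) → ℝ))
      (refineLaw sig ε δ D) :=
    (iIndepFun_pi (μ := fun j : RefineIdx sig ε δ =>
      (unifLaw (regionLo sig j.1 j.2.1) (regionHi sig j.1 j.2.1)).prod D)
      (X := fun _ => (querySet sig c s k side).indicator (1 : ℝ × ℝ → ℝ))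
      fun _ => (measurable_one.indicator hQ).aemeasurable).precomp he
  have hp : ∀ r, (refineLaw sig ε δ D).real (B r) = queryProb D sig c s k side := fun r =>
    (measurePreserving_eval (fun j : RefineIdx sig ε δ =>
      (unifLaw (regionLo sig j.1 j.2.1) (regionHi sig j.1 j.2.1)).prod D) (e r)
      ).measureReal_preimage hQ.nullMeasurableSet
  have h1 := real_lt_abs_freq_sub_queryProb_le hsig hε hδ hδ1 hD hc s k side
    (B := B) (fun r => (measurable_pi_apply (e r)) hQ) hind hp
  refine le_of_eq_of_le (congrArg _ ?_) h1
  classical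
  ext y
  have h2 : ∀ r, (B r).indicator (1 : (RefineIdx sig ε δ → ℝ × ℝ) → ℝ) y =
      if y ⟨s, k, side, r⟩ ∈ querySet sig c s k side then 1 else 0 := by
    intro r
    rw [Set.indicator_apply]
    rfl
  simp only [Set.mem_ofPred_eq, refineFreq, h2]

omit hδ hδ1 in
/-- If all frequencies are accurate, then so is the estimate. -/
theorem abs_estimate_sub_mean_le {D : Measure ℝ} (hD : D ∈ meanVarFamily lam sig) {c : ℝ}
    (hc : |c - ∫ y, y ∂D| ≤ 3 * sig) {f : Bool → Fin (iMax sig ε) → Bool → ℝ}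
    (hf : ∀ s k side, |f s k side - queryProb D sig c s k side| ≤ epsRegion sig ε k) :
    |c + ∑ s : Bool, ∑ k : Fin (iMax sig ε),
      (regionLo sig s k * f s k false + regionHi sig s k * f s k true) - ∫ y, y ∂D| ≤ ε := by
  have h1 := abs_sum_queryProb_sub_mean_le hsig hε hD hc
  have hI : (0 : ℝ) < iMax sig ε := Nat.cast_pos.2 (by linarith [(iMax_spec hsig hε).1])
  have hterm : ∀ (s : Bool) (k : Fin (iMax sig ε)),
      |regionLo sig s k * f s k false + regionHi sig s k * f s k true -
        (regionLo sig s k * queryProb D sig c s k false +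
          regionHi sig s k * queryProb D sig c s k true)| ≤ ε / (4 * iMax sig ε) := by
    intro s k
    have hm1 := mSeq_nonneg k
    have hm2 : 0 < mSeq (k + 1) := hm1.trans_lt (mSeq_lt_succ k)
    have hab : |regionLo sig s k| + |regionHi sig s k| =
        sig * mSeq k + sig * mSeq (k + 1) := by
      have h3 : |sig * mSeq k| = sig * mSeq k := abs_of_nonneg (by positivity)
      have h4 : |sig * mSeq (k + 1)| = sig * mSeq (k + 1) := abs_of_nonneg (by positivity)
      cases s <;> simp only [regionLo, regionHi, Bool.false_eq_true, if_false, if_true, abs_neg,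
        h3, h4]
      ring
    calc _ = |regionLo sig s k * (f s k false - queryProb D sig c s k false) +
          regionHi sig s k * (f s k true - queryProb D sig c s k true)| := by congr 1; ring
      _ ≤ |regionLo sig s k| * |f s k false - queryProb D sig c s k false| +
          |regionHi sig s k| * |f s k true - queryProb D sig c s k true| := by
          rw [← abs_mul, ← abs_mul]
          exact abs_add_le _ _
      _ ≤ |regionLo sig s k| * epsRegion sig ε k + |regionHi sig s k| * epsRegion sig ε k := by
          gcongr <;> exact hf _ _ _
      _ = ε / (4 * iMax sig ε) := by
          rw [← add_mul, hab, epsRegion]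
          field_simp
  have h2 : |∑ s : Bool, ∑ k : Fin (iMax sig ε),
      (regionLo sig s k * f s k false + regionHi sig s k * f s k true -
        (regionLo sig s k * queryProb D sig c s k false +
          regionHi sig s k * queryProb D sig c s k true))| ≤ ε / 2 := by
    refine (Finset.abs_sum_le_sum_abs _ _).trans ((Finset.sum_le_sum fun s _ =>
      (Finset.abs_sum_le_sum_abs _ _).trans (Finset.sum_le_sum fun k _ => hterm s k)).trans_eq ?_)
    simp only [Finset.sum_const, Finset.card_univ, Fintype.card_bool, Fintype.card_fin,
      nsmul_eq_mul]
    push_cast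
    field_simp
    norm_num
  simp only [Finset.sum_sub_distrib] at h2
  rw [abs_le] at h1 h2 ⊢
  constructor <;> linarith [h1.1, h1.2, h2.1, h2.2]

theorem refineLaw_real_estimate_le {D : Measure ℝ} (hD : D ∈ meanVarFamily lam sig) {c : ℝ}
    (hc : |c - ∫ y, y ∂D| ≤ 3 * sig) :
    (refineLaw sig ε δ D).real {y | ¬ |c + ∑ s : Bool, ∑ k : Fin (iMax sig ε),
      (regionLo sig s k * refineFreq sig ε δ c s k false y +
        regionHi sig s k * refineFreq sig ε δ c s k true y) - ∫ y, y ∂D| ≤ ε} ≤ δ / 3 := by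
  have hD1 := hD.1
  have := isProbabilityMeasure_refineLaw (ε := ε) (δ := δ) hsig D
  have hI : (0 : ℝ) < iMax sig ε := Nat.cast_pos.2 (by linarith [(iMax_spec hsig hε).1])
  let bad : Bool × Fin (iMax sig ε) × Bool → Set (RefineIdx sig ε δ → ℝ × ℝ) := fun i =>
    {y | epsRegion sig ε i.2.1 < |refineFreq sig ε δ c i.1 i.2.1 i.2.2 y -
      queryProb D sig c i.1 i.2.1 i.2.2|}
  have hsub : {y | ¬ |c + ∑ s : Bool, ∑ k : Fin (iMax sig ε),
      (regionLo sig s k * refineFreq sig ε δ c s k false y +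
        regionHi sig s k * refineFreq sig ε δ c s k true y) - ∫ y, y ∂D| ≤ ε} ⊆ ⋃ i, bad i := by
    intro y hy
    by_contra hno
    refine hy (abs_estimate_sub_mean_le hsig hε hD hc
      (f := fun s k side => refineFreq sig ε δ c s k side y) fun s k side => ?_)
    rw [Set.mem_iUnion, not_exists] at hno
    exact not_lt.1 (hno (s, k, side))
  calc _ ≤ (refineLaw sig ε δ D).real (⋃ i, bad i) := measureReal_mono hsub (measure_ne_top _ _)
    _ ≤ ∑ i, (refineLaw sig ε δ D).real (bad i) := measureReal_iUnion_fintype_le _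
    _ ≤ ∑ i : Bool × Fin (iMax sig ε) × Bool, deltaRegion sig ε δ :=
        Finset.sum_le_sum fun i _ => refineLaw_real_lt_abs_le hsig hε hδ hδ1 hD hc _ _ _
    _ = δ / 3 := by
        simp only [Finset.sum_const, Finset.card_univ, Fintype.card_prod, Fintype.card_bool,
          Fintype.card_fin, nsmul_eq_mul, deltaRegion]
        push_cast
        field_simp
        norm_num

end Refinement

/-! ### The estimator as a function of independent samples -/

theorem measurePreserving_finAppend (D : Measure ℝ) [IsProbabilityMeasure D] (n m : ℕ) :
    MeasurePreserving (fun p : (Fin n → ℝ) × (Fin m → ℝ) => Fin.append p.1 p.2)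
      ((Measure.pi fun _ => D).prod (Measure.pi fun _ => D)) (Measure.pi fun _ => D) := by
  have hmeas : Measurable fun p : (Fin n → ℝ) × (Fin m → ℝ) => Fin.append p.1 p.2 := by
    refine measurable_pi_iff.2 fun i => ?_
    induction i using Fin.addCases with
    | left i => simp only [Fin.append_left]; fun_prop
    | right i => simp only [Fin.append_right]; fun_prop
  refine ⟨hmeas, (Measure.pi_eq fun s hs => ?_).symm⟩
  have h1 : (fun p : (Fin n → ℝ) × (Fin m → ℝ) => Fin.append p.1 p.2) ⁻¹' Set.univ.pi s =
      (Set.univ.pi fun i => s (Fin.castAdd m i)) ×ˢ (Set.univ.pi fun i => s (Fin.natAdd n i)) := by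
    ext p
    simp only [Set.mem_preimage, Set.mem_univ_pi, Set.mem_prod]
    constructor
    · intro h
      exact ⟨fun i => by simpa using h (Fin.castAdd m i), fun i => by
        simpa using h (Fin.natAdd n i)⟩
    · rintro ⟨ha, hb⟩ i
      induction i using Fin.addCases with
      | left i => simpa using ha i
      | right i => simpa using hb i
  rw [Measure.map_apply hmeas (MeasurableSet.univ_pi hs), h1, Measure.prod_prod, Measure.pi_pi,
    Measure.pi_pi, Fin.prod_univ_add]

theorem measurePreserving_comp_equiv {ι κ : Type*} [Fintype ι] [Fintype κ] (D : Measure ℝ)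
    [IsProbabilityMeasure D] (e : ι ≃ κ) :
    MeasurePreserving (fun (x : ι → ℝ) (i : κ) => x (e.symm i))
      (Measure.pi fun _ => D) (Measure.pi fun _ => D) := by
  have hmeas : Measurable fun (x : ι → ℝ) (i : κ) => x (e.symm i) :=
    measurable_pi_iff.2 fun i => measurable_pi_apply _
  refine ⟨hmeas, (Measure.pi_eq fun s hs => ?_).symm⟩
  have h1 : (fun (x : ι → ℝ) (i : κ) => x (e.symm i)) ⁻¹' Set.univ.pi s =
      Set.univ.pi fun j => s (e j) := by
    ext x
    simp only [Set.mem_preimage, Set.mem_univ_pi]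
    exact ⟨fun h j => by simpa using h (e j), fun h i => by simpa using h (e.symm i)⟩
  rw [Measure.map_apply hmeas (MeasurableSet.univ_pi hs), h1, Measure.pi_pi,
    e.prod_comp fun i => D (s i)]

theorem measurePreserving_prodProdProdComm {α β γ δ : Type*} [MeasurableSpace α]
    [MeasurableSpace β] [MeasurableSpace γ] [MeasurableSpace δ] (μ : Measure α) (ν : Measure β)
    (τ : Measure γ) (ρ : Measure δ) [SFinite μ] [SFinite ν] [SFinite τ] [SFinite ρ] :
    MeasurePreserving (fun p : (α × β) × γ × δ => ((p.1.1, p.2.1), (p.1.2, p.2.2)))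
      ((μ.prod ν).prod (τ.prod ρ)) ((μ.prod τ).prod (ν.prod ρ)) := by
  have h1 : MeasurePreserving (fun p : β × γ × δ => (p.2.1, (p.1, p.2.2)))
      (ν.prod (τ.prod ρ)) (τ.prod (ν.prod ρ)) :=
    (measurePreserving_prodAssoc τ ν ρ).comp
      ((Measure.measurePreserving_swap.prod (MeasurePreserving.id ρ)).comp
        (measurePreserving_prodAssoc ν τ ρ).symm)
  exact (measurePreserving_prodAssoc μ τ (ν.prod ρ)).symm.comp
    (((MeasurePreserving.id μ).prod h1).comp (measurePreserving_prodAssoc μ ν (τ.prod ρ)))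

section Estimator

variable (loc : OneBitProtocol (ℝ × ℝ)) (sig ε δ : ℝ)

/-- The seed and the samples of the estimator, assembled from those of the localization and from the
pairs of a random end point and a sample for each refinement query. -/
noncomputable def assemble (hsig : 0 < sig)
    (p : (loc.Seed × (Fin loc.n → ℝ)) × (RefineIdx sig ε δ → ℝ × ℝ)) :
    (meanEstimator loc sig ε δ hsig).Seed × (Fin (meanEstimator loc sig ε δ hsig).n → ℝ) :=
  ((p.1.1, fun j => (p.2 j).1),
    Fin.append p.1.2 fun i => (p.2 ((refineEquiv sig ε δ).symm i)).2)

theorem measurePreserving_assemble (hsig : 0 < sig) (D : Measure ℝ) [IsProbabilityMeasure D] :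
    MeasurePreserving (assemble loc sig ε δ hsig) ((loc.joint D).prod (refineLaw sig ε δ D))
      ((meanEstimator loc sig ε δ hsig).joint D) := by
  have hU : ∀ j : RefineIdx sig ε δ, IsProbabilityMeasure
      (unifLaw (regionLo sig j.1 j.2.1) (regionHi sig j.1 j.2.1)) := fun j =>
    isProbabilityMeasure_unifLaw (regionLo_lt_regionHi hsig _ _)
  have h1 := measurePreserving_arrowProdEquivProdArrow ℝ ℝ (RefineIdx sig ε δ)
    (fun j => unifLaw (regionLo sig j.1 j.2.1) (regionHi sig j.1 j.2.1)) (fun _ => D)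
  have h2 := ((MeasurePreserving.id (Measure.pi fun j : RefineIdx sig ε δ =>
    unifLaw (regionLo sig j.1 j.2.1) (regionHi sig j.1 j.2.1))).prod
    (measurePreserving_comp_equiv D (refineEquiv sig ε δ))).comp h1
  have h3 := measurePreserving_prodProdProdComm loc.law (Measure.pi fun _ : Fin loc.n => D)
    (Measure.pi fun j : RefineIdx sig ε δ =>
      unifLaw (regionLo sig j.1 j.2.1) (regionHi sig j.1 j.2.1))
    (Measure.pi fun _ : Fin (Fintype.card (RefineIdx sig ε δ)) => D)
  have h4 := (MeasurePreserving.id (loc.law.prod (Measure.pi fun j : RefineIdx sig ε δ =>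
    unifLaw (regionLo sig j.1 j.2.1) (regionHi sig j.1 j.2.1)))).prod
    (measurePreserving_finAppend D loc.n (Fintype.card (RefineIdx sig ε δ)))
  exact h4.comp (h3.comp ((MeasurePreserving.id (loc.law.prod
    (Measure.pi fun _ : Fin loc.n => D))).prod h2))

theorem estQuery_of_length (ω : loc.Seed × (RefineIdx sig ε δ → ℝ)) (j : RefineIdx sig ε δ)
    {h : List Bool} (hh : h.length = loc.n + (refineEquiv sig ε δ j : ℕ)) :
    estQuery loc sig ε δ ω h =
      regionQuery sig (centre loc ω.1 h) j.1 j.2.1 j.2.2.1 (ω.2 j) := by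
  have hlt := (refineEquiv sig ε δ j).2
  have hr : h.length - loc.n < Fintype.card (RefineIdx sig ε δ) := by omega
  have hj : (refineEquiv sig ε δ).symm ⟨h.length - loc.n, hr⟩ = j := by
    rw [Equiv.symm_apply_eq]
    exact Fin.ext (show h.length - loc.n = refineEquiv sig ε δ j by omega)
  unfold estQuery
  rw [if_neg (by omega), dif_pos hr]
  generalize (refineEquiv sig ε δ).symm ⟨h.length - loc.n, hr⟩ = j' at hj
  rw [hj]

/-- The output of the estimator is the centre found by the localization plus the contributions of
the regions, with the frequencies of positive answers to non-adaptive queries. -/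
theorem meanEstimator_run_assemble (hsig : 0 < sig)
    (p : (loc.Seed × (Fin loc.n → ℝ)) × (RefineIdx sig ε δ → ℝ × ℝ)) :
    (meanEstimator loc sig ε δ hsig).run (assemble loc sig ε δ hsig p).1
      (assemble loc sig ε δ hsig p).2 =
      ((loc.run p.1.1 p.1.2).1 + (loc.run p.1.1 p.1.2).2) / 2 +
        ∑ s : Bool, ∑ k : Fin (iMax sig ε),
          (regionLo sig s k * refineFreq sig ε δ (((loc.run p.1.1 p.1.2).1 +
            (loc.run p.1.1 p.1.2).2) / 2) s k false p.2 +
          regionHi sig s k * refineFreq sig ε δ (((loc.run p.1.1 p.1.2).1 +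
            (loc.run p.1.1 p.1.2).2) / 2) s k true p.2) := by
  classical
  obtain ⟨⟨ω, x⟩, y⟩ := p
  set c : ℝ := ((loc.run ω x).1 + (loc.run ω x).2) / 2 with hc
  let T : RefineIdx sig ε δ → ℝ := fun j => (y j).1
  let q := estQuery loc sig ε δ (ω, T)
  let xs := List.ofFn (Fin.append x fun i => (y ((refineEquiv sig ε δ).symm i)).2)
  set A := answers q xs with hA
  have hlen : xs.length = loc.n + Fintype.card (RefineIdx sig ε δ) := List.length_ofFn
  have htake : A.take loc.n = answers (loc.query ω) (List.ofFn x) := by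
    rw [hA, take_answers]
    have h1 : xs.take loc.n = List.ofFn x := by
      simp only [xs, List.ofFn_fin_append]
      exact List.take_left' List.length_ofFn
    rw [h1]
    refine answers_congr _ fun l hl => ?_
    rw [List.length_ofFn] at hl
    simp only [q, estQuery, if_pos hl]
  have hcentre : ∀ h : List Bool, h.take loc.n = A.take loc.n → centre loc ω h = c := by
    intro h hh
    rw [centre, hh, htake]
    rfl
  have hbit : ∀ j : RefineIdx sig ε δ,
      A.getD (loc.n + (refineEquiv sig ε δ j : ℕ)) false =
        decide (y j ∈ querySet sig c j.1 j.2.1 j.2.2.1) := by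
    intro j
    have hlt : loc.n + (refineEquiv sig ε δ j : ℕ) < xs.length := by
      rw [hlen]
      exact Nat.add_lt_add_left (refineEquiv sig ε δ j).2 _
    have hlt' : loc.n + (refineEquiv sig ε δ j : ℕ) < A.length := by
      rwa [hA, length_answers]
    rw [List.getD_eq_getElem _ _ hlt']
    have h1 := getElem_answers q xs _ hlt
    refine h1.trans ?_
    have h2 : xs[loc.n + (refineEquiv sig ε δ j : ℕ)] = (y j).2 := by
      simp only [xs, List.getElem_ofFn]
      exact (Fin.append_right x (fun i => (y ((refineEquiv sig ε δ).symm i)).2)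
        (refineEquiv sig ε δ j)).trans (by rw [Equiv.symm_apply_apply])
    have hl : (A.take (loc.n + (refineEquiv sig ε δ j : ℕ))).length =
        loc.n + (refineEquiv sig ε δ j : ℕ) := by
      rw [List.length_take, min_eq_left hlt'.le]
    have h3 : q (A.take (loc.n + (refineEquiv sig ε δ j : ℕ))) =
        regionQuery sig c j.1 j.2.1 j.2.2.1 (T j) := by
      simp only [q]
      rw [estQuery_of_length loc sig ε δ _ j hl,
        hcentre _ (by rw [List.take_take, min_eq_left (by omega)])]
    rw [h2, h3]
    rfl
  have hfreq : ∀ s k side, empFreq loc sig ε δ A s k side = refineFreq sig ε δ c s k side y := by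
    intro s k side
    simp only [empFreq, refineFreq, hbit, decide_eq_true_eq]
  change estOutput loc sig ε δ (ω, T) A = _
  simp only [estOutput, hfreq, hcentre A rfl]

/-- An estimator with a good localization fails with probability at most `δ / 3` plus twice the
failure probability of the localization. -/
theorem meanEstimator_isPAC {lam : ℝ} (hsig : 0 < sig) (hε : 0 < ε) (hδ : 0 < δ) (hδ1 : δ < 1)
    (hloc : IsNoisyMedianSearch loc lam sig (δ / 3)) :
    (meanEstimator loc sig ε δ hsig).IsPAC ε δ (meanVarFamily lam sig) := by
  intro D hD
  have hD1 := hD.1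
  have hR := isProbabilityMeasure_refineLaw (ε := ε) (δ := δ) hsig D
  have hJ : IsProbabilityMeasure (loc.joint D) := by
    unfold OneBitProtocol.joint
    infer_instance
  let P := meanEstimator loc sig ε δ hsig
  have hJP : IsProbabilityMeasure (P.joint D) := by
    unfold OneBitProtocol.joint
    infer_instance
  -- The events that the localization succeeds at either end.
  let EL : Set (loc.Seed × (Fin loc.n → ℝ)) := {p | (Set.Icc (cdf D (loc.run p.1 p.2).1)
    (cdf D ((loc.run p.1 p.2).1 + sig)) ∩ Set.Ioo (0.49 : ℝ) 0.5).Nonempty}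
  let EU : Set (loc.Seed × (Fin loc.n → ℝ)) := {p | (Set.Icc (cdf D ((loc.run p.1 p.2).2 - sig))
    (cdf D (loc.run p.1 p.2).2) ∩ Set.Ioo (0.5 : ℝ) 0.51).Nonempty}
  have hELm : MeasurableSet EL :=
    loc.measurable_run (measurableSet_setOf_lower D sig (by norm_num) hsig)
  have hEUm : MeasurableSet EU :=
    loc.measurable_run (measurableSet_setOf_upper D sig (by norm_num) hsig)
  have hEL : (loc.joint D).real ELᶜ ≤ δ / 3 := by
    have : 1 - δ / 3 ≤ (loc.joint D).real EL := hloc.lower D hD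
    rw [probReal_compl_eq_one_sub hELm]
    linarith
  have hEU : (loc.joint D).real EUᶜ ≤ δ / 3 := by
    have : 1 - δ / 3 ≤ (loc.joint D).real EU := hloc.upper D hD
    rw [probReal_compl_eq_one_sub hEUm]
    linarith
  have hgood : (loc.joint D).real (EL ∩ EU)ᶜ ≤ δ / 3 + δ / 3 := by
    rw [Set.compl_inter]
    exact (measureReal_union_le _ _).trans (add_le_add hEL hEU)
  let fail : Set (P.Seed × (Fin P.n → ℝ)) := {p | ¬ |P.run p.1 p.2 - ∫ x, x ∂D| ≤ ε}
  have hfailm : MeasurableSet fail := by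
    have h1 : Measurable fun p : P.Seed × (Fin P.n → ℝ) => |P.run p.1 p.2 - ∫ x, x ∂D| :=
      (P.measurable_run.sub_const _).abs
    exact (measurableSet_le h1 measurable_const).compl
  have hmp := measurePreserving_assemble loc sig ε δ hsig D
  have hsection : ∀ a : loc.Seed × (Fin loc.n → ℝ),
      refineLaw sig ε δ D (Prod.mk a ⁻¹' (assemble loc sig ε δ hsig ⁻¹' fail)) ≤
        ((EL ∩ EU)ᶜ).indicator (fun _ => 1) a + ENNReal.ofReal (δ / 3) := by
    intro a
    by_cases ha : a ∈ EL ∩ EU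
    · have hc := abs_midpoint_sub_mean_le hsig hD ha.1 ha.2
      have h1 := refineLaw_real_estimate_le hsig hε hδ hδ1 hD hc
      have h2 : Prod.mk a ⁻¹' (assemble loc sig ε δ hsig ⁻¹' fail) = {y | ¬ |((loc.run a.1 a.2).1 +
          (loc.run a.1 a.2).2) / 2 + ∑ s : Bool, ∑ k : Fin (iMax sig ε),
            (regionLo sig s k * refineFreq sig ε δ (((loc.run a.1 a.2).1 +
              (loc.run a.1 a.2).2) / 2) s k false y +
            regionHi sig s k * refineFreq sig ε δ (((loc.run a.1 a.2).1 +
              (loc.run a.1 a.2).2) / 2) s k true y) - ∫ y, y ∂D| ≤ ε} := by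
        ext y
        have h3 := meanEstimator_run_assemble loc sig ε δ hsig (a, y)
        refine not_congr ?_
        rw [← h3]
      rw [h2]
      refine le_add_left ?_
      rw [← ENNReal.ofReal_toReal (measure_ne_top _ _)]
      exact ENNReal.ofReal_le_ofReal h1
    · rw [Set.indicator_of_mem (Set.mem_compl ha)]
      exact le_add_right prob_le_one
  have hfail : P.joint D fail ≤ ENNReal.ofReal δ := by
    rw [← hmp.measure_preimage hfailm.nullMeasurableSet,
      Measure.prod_apply (hmp.measurable hfailm)]
    calc _ ≤ ∫⁻ a, (((EL ∩ EU)ᶜ).indicator (fun _ => 1) a + ENNReal.ofReal (δ / 3))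
          ∂(loc.joint D) := lintegral_mono hsection
      _ = loc.joint D (EL ∩ EU)ᶜ + ENNReal.ofReal (δ / 3) := by
          rw [lintegral_add_right _ measurable_const, lintegral_const, measure_univ, mul_one,
            lintegral_indicator_const (hELm.inter hEUm).compl, one_mul]
      _ ≤ ENNReal.ofReal (δ / 3 + δ / 3) + ENNReal.ofReal (δ / 3) := by
          gcongr
          rw [← ENNReal.ofReal_toReal (measure_ne_top (loc.joint D) _)]
          exact ENNReal.ofReal_le_ofReal hgood
      _ = ENNReal.ofReal δ := by
          rw [← ENNReal.ofReal_add (by positivity) (by positivity)]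
          ring_nf
  have hfail' : (P.joint D).real fail ≤ δ := ENNReal.toReal_le_of_le_ofReal hδ.le hfail
  have h1 : {p : P.Seed × (Fin P.n → ℝ) | P.run p.1 p.2 ∈ {y | |y - ∫ x, x ∂D| ≤ ε}} = failᶜ := by
    ext p
    simp [fail]
  rw [OneBitProtocol.prob, h1, probReal_compl_eq_one_sub hfailm]
  linarith

theorem meanEstimator_onlyIntervalQueries (hsig : 0 < sig) {G : Set ℝ}
    (hloc : loc.OnlyThresholdQueries G) :
    (meanEstimator loc sig ε δ hsig).OnlyIntervalQueries := by
  intro ω h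
  change (estQuery loc sig ε δ ω h).OrdConnected
  unfold estQuery
  split_ifs with h1 h2
  · obtain ⟨θ, -, hθ⟩ := hloc ω.1 h
    rw [hθ]
    exact Set.ordConnected_Iic
  · generalize (refineEquiv sig ε δ).symm ⟨h.length - loc.n, h2⟩ = j
    obtain ⟨s, k, side, r⟩ := j
    have hreg : (region sig s k).OrdConnected := by
      unfold region
      split_ifs
      · exact Set.ordConnected_Ico
      · exact Set.ordConnected_Ioc
    refine ⟨fun a ha b hb z hz => ⟨hreg.out ha.1 hb.1 ⟨?_, ?_⟩, ?_⟩⟩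
    · linarith [hz.1]
    · linarith [hz.2]
    · have ha' := ha.2
      have hb' := hb.2
      cases side
      · simp only [Bool.false_eq_true, if_false] at hb' ⊢
        linarith [hz.2]
      · simp only [if_true] at ha' ⊢
        linarith [hz.1]
  · exact Set.ordConnected_univ

end Estimator

/-! ### Numbers of samples -/

theorem one_le_rlog (x : ℝ) : 1 ≤ rlog x := le_max_left _ _

theorem log_le_rlog (x : ℝ) : Real.log x ≤ rlog x := le_max_right _ _

theorem rlog_mono {x y : ℝ} (hx : 0 < x) (hxy : x ≤ y) : rlog x ≤ rlog y :=
  max_le_max le_rfl (Real.log_le_log hx hxy)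

theorem log_numGaps_le {lam sig : ℝ} (hsig : 0 < sig) (hls : sig ≤ lam) :
    Real.log (numGaps lam sig) ≤ Real.log 8 + Real.log (lam / sig) := by
  have h1 : 1 ≤ lam / sig := (one_le_div hsig).2 hls
  have h2 : (numGaps lam sig : ℝ) ≤ 8 * (lam / sig) := by
    have := Nat.ceil_lt_add_one (zero_le_one.trans h1)
    unfold numGaps
    push_cast
    linarith
  have h3 : (0 : ℝ) < numGaps lam sig := by
    unfold numGaps
    positivity
  rw [← Real.log_mul (by norm_num) (by positivity)]
  exact Real.log_le_log h3 h2

/-- A number of rounds that makes the search fail with probability at most `δ / 3`. -/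
theorem exists_rounds {lam sig δ : ℝ} (hsig : 0 < sig) (hls : sig ≤ lam) (hδ : 0 < δ)
    (hδ1 : δ < 1) : ∃ T : ℕ, numGaps lam sig * Real.exp (-(8e-8 * T)) ≤ δ / 3 ∧
      (T : ℝ) ≤ 7e7 * (Real.log (lam / sig) + rlog (1 / δ)) := by
  have hN : (0 : ℝ) < numGaps lam sig := by
    unfold numGaps
    positivity
  have h0 : 0 ≤ Real.log (lam / sig) := Real.log_nonneg ((one_le_div hsig).2 hls)
  have h24 : Real.log 8 + Real.log 3 ≤ 4 := by
    rw [← Real.log_mul (by norm_num) (by norm_num), Real.log_le_iff_le_exp (by norm_num)]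
    have h := Real.exp_one_gt_d9
    have h' : Real.exp 4 = Real.exp 1 ^ 4 := by rw [← Real.exp_nat_mul]; norm_num
    rw [h']
    calc (8 * 3 : ℝ) ≤ 2.7 ^ 4 := by norm_num
      _ ≤ Real.exp 1 ^ 4 := by gcongr; linarith
  have h3 : Real.log (3 / δ) = Real.log 3 + Real.log (1 / δ) := by
    rw [← Real.log_mul (by norm_num) (by positivity)]
    ring_nf
  have hδlog : 0 ≤ Real.log (1 / δ) := Real.log_nonneg (by rw [le_div_iff₀ hδ]; linarith)
  have h8 := log_numGaps_le hsig hls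
  have hr1 := one_le_rlog (1 / δ)
  have hr2 := log_le_rlog (1 / δ)
  have hN1 : 0 ≤ Real.log (numGaps lam sig) := Real.log_nonneg (by
    have : 1 ≤ numGaps lam sig := by unfold numGaps; omega
    exact_mod_cast this)
  have hlog3 : 0 ≤ Real.log 3 := Real.log_nonneg (by norm_num)
  set x : ℝ := (Real.log (numGaps lam sig) + Real.log (3 / δ)) / 8e-8 with hx
  have hx0 : 0 ≤ x := div_nonneg (by linarith) (by norm_num)
  have hx8 : x * 8e-8 = Real.log (numGaps lam sig) + Real.log (3 / δ) :=
    div_mul_cancel₀ _ (by norm_num)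
  refine ⟨⌈x⌉₊, ?_, ?_⟩
  · have h1 : x ≤ ⌈x⌉₊ := Nat.le_ceil x
    calc numGaps lam sig * Real.exp (-(8e-8 * ⌈x⌉₊))
        ≤ numGaps lam sig * Real.exp (-(Real.log (numGaps lam sig) + Real.log (3 / δ))) := by
          gcongr
          linarith
      _ = δ / 3 := by
          rw [Real.exp_neg, Real.exp_add, Real.exp_log hN, Real.exp_log (by positivity)]
          field_simp
  · have h1 := (Nat.ceil_lt_add_one hx0).le
    linarith

section Counts

variable {sig ε δ : ℝ} (hε : 0 < ε) (hεs : ε ≤ sig)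

include hε hεs

theorem iMax_le : (iMax sig ε : ℝ) ≤ 10 * rlog (sig / ε) ∧
    (2 : ℝ) ^ iMax sig ε ≤ 64 * (sig / ε) := by
  have hsig : 0 < sig := hε.trans_le hεs
  have hu : 1 ≤ sig / ε := (one_le_div hε).2 hεs
  have hρ := one_le_rlog (sig / ε)
  obtain ⟨h5, -⟩ := iMax_spec hsig hε
  rcases h5.eq_or_lt with h | h
  · rw [← h]
    constructor <;> norm_num <;> linarith
  · obtain ⟨n, hn⟩ : ∃ n, iMax sig ε = n + 6 := ⟨iMax sig ε - 6, by omega⟩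
    have h1 := Nat.notMem_of_lt_sInf (show n + 5 < sInf _ from (by omega : n + 5 < iMax sig ε))
    rw [Set.mem_ofPred_eq, not_and, not_le] at h1
    have h2 := h1 (by omega)
    rw [one_div, inv_pow, lt_inv_comm₀ (by positivity) (by positivity), inv_div,
      lt_div_iff₀ (by positivity)] at h2
    have h3 : (2 : ℝ) ^ n < sig / ε := by
      rw [lt_div_iff₀ hε]
      rw [pow_add] at h2
      nlinarith [pow_pos (two_pos : (0 : ℝ) < 2) n]
    have h4 : n * Real.log 2 ≤ rlog (sig / ε) := by
      rw [← Real.log_pow]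
      exact (Real.log_le_log (by positivity) h3.le).trans (log_le_rlog _)
    have h6 := Real.log_two_gt_d9
    have h7 : (n : ℝ) / 2 ≤ n * Real.log 2 := by
      nlinarith [(Nat.cast_nonneg n : (0 : ℝ) ≤ n)]
    rw [hn]
    constructor
    · push_cast; linarith
    · rw [pow_add]; linarith

/-- Each region needs `O(iMax ^ 2 * (sig / ε) ^ 2)` samples, up to a logarithm: the far regions are
long, but for them the gain in Bernstein's inequality makes up for this. -/
theorem nRegion_le (hδ : 0 < δ) (hδ1 : δ < 1) {k : ℕ} (hk : k < iMax sig ε) :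
    (nRegion sig ε δ k : ℝ) ≤ 8192 * (iMax sig ε ^ 2 * (sig / ε) ^ 2) *
      Real.log (2 / deltaRegion sig ε δ) + 1 := by
  have hsig : 0 < sig := hε.trans_le hεs
  have hu : 1 ≤ sig / ε := (one_le_div hε).2 hεs
  obtain ⟨hδ', hδ1'⟩ := deltaRegion_mem hsig hε hδ hδ1
  have hlog : 0 < Real.log (2 / deltaRegion sig ε δ) :=
    Real.log_pos (by rw [lt_div_iff₀ hδ']; linarith)
  have hm0 := mSeq_nonneg k
  have hm1 := mSeq_lt_succ k
  have hm : 0 < mSeq (k + 1) := hm0.trans_lt hm1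
  have hε' := epsRegion_pos hsig hε k
  have hI : (1 : ℝ) ≤ iMax sig ε := by
    have := (iMax_spec hsig hε).1
    exact_mod_cast (by omega : 1 ≤ iMax sig ε)
  have hinv : 1 / epsRegion sig ε k =
      4 * iMax sig ε * (mSeq k + mSeq (k + 1)) * (sig / ε) := by
    unfold epsRegion
    field_simp
  unfold nRegion
  split_ifs with h4
  · refine (Nat.ceil_lt_add_one (by positivity)).le.trans ?_
    gcongr
    have h16 : mSeq (k + 1) ≤ 16 := (mSeq_strictMono.monotone h4).trans (by norm_num [mSeq])
    rw [show 1 / (2 * epsRegion sig ε k ^ 2) = (1 / epsRegion sig ε k) ^ 2 / 2 by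
      rw [one_div, one_div, mul_inv, inv_pow]; ring, hinv]
    have h32 : (mSeq k + mSeq (k + 1)) ^ 2 ≤ 32 ^ 2 := by gcongr; linarith
    calc (4 * iMax sig ε * (mSeq k + mSeq (k + 1)) * (sig / ε)) ^ 2 / 2 =
          8 * (mSeq k + mSeq (k + 1)) ^ 2 * (iMax sig ε ^ 2 * (sig / ε) ^ 2) := by ring
      _ ≤ 8 * 32 ^ 2 * (iMax sig ε ^ 2 * (sig / ε) ^ 2) := by gcongr
      _ = 8192 * (iMax sig ε ^ 2 * (sig / ε) ^ 2) := by norm_num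
  · refine (Nat.ceil_lt_add_one (by positivity)).le.trans ?_
    gcongr
    rw [show 1 / epsRegion sig ε k ^ 2 = (1 / epsRegion sig ε k) ^ 2 by rw [one_div_pow], hinv]
    have hmI : mSeq (k + 1) ≤ 64 * (sig / ε) :=
      (mSeq_strictMono.monotone hk).trans ((mSeq_le_two_pow _).trans (iMax_le hε hεs).2)
    have h2m : mSeq k + mSeq (k + 1) ≤ 2 * mSeq (k + 1) := by linarith
    have hfirst : 8 / mSeq (k + 1) ^ 2 *
        (4 * iMax sig ε * (mSeq k + mSeq (k + 1)) * (sig / ε)) ^ 2 ≤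
        512 * (iMax sig ε ^ 2 * (sig / ε) ^ 2) := by
      calc _ ≤ 8 / mSeq (k + 1) ^ 2 *
          (4 * iMax sig ε * (2 * mSeq (k + 1)) * (sig / ε)) ^ 2 := by gcongr
        _ = 512 * (iMax sig ε ^ 2 * (sig / ε) ^ 2) := by
          field_simp
          norm_num
    have hsecond : 2 / 3 * (4 * iMax sig ε * (mSeq k + mSeq (k + 1)) * (sig / ε)) ≤
        512 * (iMax sig ε ^ 2 * (sig / ε) ^ 2) := by
      calc _ ≤ 2 / 3 * (4 * iMax sig ε * (2 * (64 * (sig / ε))) * (sig / ε)) := by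
            gcongr
            linarith
        _ = 1024 / 3 * (iMax sig ε * 1 * (sig / ε) ^ 2) := by ring
        _ ≤ 512 * (iMax sig ε * iMax sig ε * (sig / ε) ^ 2) := by
            gcongr
            norm_num
        _ = _ := by ring
    have : 0 ≤ iMax sig ε ^ 2 * (sig / ε) ^ 2 := by positivity
    linarith

theorem card_refineIdx_le (hδ : 0 < δ) (hδ1 : δ < 1) :
    (Fintype.card (RefineIdx sig ε δ) : ℝ) ≤ 2.3e8 * ((sig / ε) ^ 2 * rlog (sig / ε) ^ 3 *
      rlog (rlog (sig / ε) / δ)) := by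
  have hsig : 0 < sig := hε.trans_le hεs
  have hu : 1 ≤ sig / ε := (one_le_div hε).2 hεs
  have hρ := one_le_rlog (sig / ε)
  have hΛ := one_le_rlog (rlog (sig / ε) / δ)
  have hI5 : (5 : ℝ) ≤ iMax sig ε := by exact_mod_cast (iMax_spec hsig hε).1
  have hIρ := (iMax_le hε hεs).1
  set I : ℝ := ((iMax sig ε : ℕ) : ℝ) with hI
  set u := sig / ε with hu'
  set ρ := rlog u with hρ'
  set l := Real.log (2 / deltaRegion sig ε δ) with hl
  have hδI : 2 / deltaRegion sig ε δ = 24 * I / δ := by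
    unfold deltaRegion
    rw [← hI]
    field_simp
    norm_num
  have hl7 : l ≤ 7 * rlog (ρ / δ) := by
    have h1 : Real.log 240 ≤ 6 := by
      rw [Real.log_le_iff_le_exp (by norm_num)]
      have h' : Real.exp 6 = Real.exp 1 ^ 6 := by rw [← Real.exp_nat_mul]; norm_num
      rw [h']
      calc (240 : ℝ) ≤ 2.7 ^ 6 := by norm_num
        _ ≤ Real.exp 1 ^ 6 := by gcongr; linarith [Real.exp_one_gt_d9]
    have h2 : l ≤ Real.log 240 + Real.log (ρ / δ) := by
      rw [← Real.log_mul (by norm_num) (by positivity), hl, hδI]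
      refine Real.log_le_log (by positivity) ?_
      rw [mul_div_assoc', div_le_div_iff_of_pos_right hδ]
      linarith
    linarith [log_le_rlog (ρ / δ)]
  have hl1 : 1 ≤ l := by
    rw [hl, hδI, Real.le_log_iff_exp_le (by positivity)]
    have h1 : Real.exp 1 < 3 := by linarith [Real.exp_one_lt_d9]
    rw [le_div_iff₀ hδ]
    nlinarith [Real.exp_pos 1]
  have hterm : ∀ k : Fin (iMax sig ε), (nRegion sig ε δ k : ℝ) ≤ 8193 * (I ^ 2 * u ^ 2 * l) := by
    intro k
    have h1 := nRegion_le hε hεs hδ hδ1 k.2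
    rw [← hI, ← hu', ← hl] at h1
    have h2 : 1 ≤ I ^ 2 * u ^ 2 * l :=
      one_le_mul_of_one_le_of_one_le (one_le_mul_of_one_le_of_one_le
        (one_le_pow₀ (by linarith)) (one_le_pow₀ hu)) hl1
    linarith
  have hcard : (Fintype.card (RefineIdx sig ε δ) : ℝ) =
      4 * ∑ k : Fin (iMax sig ε), (nRegion sig ε δ k : ℝ) := by
    simp only [RefineIdx, Fintype.card_sigma, Fintype.card_fin, Finset.sum_const,
      Finset.card_univ, Fintype.card_bool, smul_eq_mul]
    push_cast
    rw [← Finset.mul_sum]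
    ring
  rw [hcard]
  calc 4 * ∑ k : Fin (iMax sig ε), (nRegion sig ε δ k : ℝ)
      ≤ 4 * ∑ k : Fin (iMax sig ε), 8193 * (I ^ 2 * u ^ 2 * l) := by
        gcongr with k
        exact hterm k
    _ = 32772 * (I ^ 3 * u ^ 2 * l) := by
        simp only [Finset.sum_const, Finset.card_univ, Fintype.card_fin, nsmul_eq_mul, ← hI]
        ring
    _ ≤ 32772 * ((10 * ρ) ^ 3 * u ^ 2 * (7 * rlog (ρ / δ))) := by gcongr
    _ = 229404000 * (u ^ 2 * ρ ^ 3 * rlog (ρ / δ)) := by ring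
    _ ≤ 2.3e8 * (u ^ 2 * ρ ^ 3 * rlog (ρ / δ)) := by
        gcongr
        norm_num

end Counts

theorem rlog_div_le {ρ δ : ℝ} (hρ : 1 ≤ ρ) (hδ : 0 < δ) :
    rlog (ρ / δ) ≤ 2 * (ρ * rlog (1 / δ)) := by
  have h1 := one_le_rlog (1 / δ)
  have h2 := log_le_rlog (1 / δ)
  refine max_le (by nlinarith) ?_
  have h3 : Real.log (ρ / δ) = Real.log ρ + Real.log (1 / δ) := by
    rw [← Real.log_mul (by positivity) (by positivity)]
    ring_nf
  have h4 := Real.log_le_sub_one_of_pos (by linarith : 0 < ρ)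
  rw [h3]
  nlinarith

theorem theorem1 :
    ∃ C : ℝ, 0 < C ∧ ∃ d : ℕ,
      ∀ (lam sig δ : ℝ) (hsig : 0 < sig), sig ≤ lam → 0 < δ → δ < 1 →
        ∃ loc : OneBitProtocol (ℝ × ℝ),
          IsNoisyMedianSearch loc lam sig (δ / 3) ∧
          (loc.n : ℝ) ≤ C * (Real.log (lam / sig) + rlog (1 / δ)) ∧
          ∀ ε : ℝ, 0 < ε →
            (meanEstimator loc sig ε δ hsig).OnlyIntervalQueries ∧
            (meanEstimator loc sig ε δ hsig).IsPAC ε δ (meanVarFamily lam sig) ∧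
            (ε ≤ sig →
              ((meanEstimator loc sig ε δ hsig).n : ℝ) ≤
                C * (sig ^ 2 / ε ^ 2 * rlog (sig / ε) ^ 3 * rlog (rlog (sig / ε) / δ) +
                  Real.log (lam / sig)) ∧
              ((meanEstimator loc sig ε δ hsig).n : ℝ) ≤
                C * (sig ^ 2 / ε ^ 2 * rlog (1 / δ) * rlog (sig / ε) ^ d +
                  Real.log (lam / sig))) := by
  refine ⟨2e9, by norm_num, 4, fun lam sig δ hsig hls hδ hδ1 => ?_⟩
  obtain ⟨T, hT, hTle⟩ := exists_rounds hsig hls hδ hδ1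
  have hloc := medianSearch_isNoisyMedianSearch hsig hls hT
  have hlog : 0 ≤ Real.log (lam / sig) := Real.log_nonneg ((one_le_div hsig).2 hls)
  have hδr := one_le_rlog (1 / δ)
  have hn : ((medianSearch lam sig T).n : ℝ) ≤
      2.8e8 * (Real.log (lam / sig) + rlog (1 / δ)) := by
    simp only [medianSearch]
    push_cast
    linarith
  refine ⟨medianSearch lam sig T, hloc, by linarith, fun ε hε =>
    ⟨meanEstimator_onlyIntervalQueries _ sig ε δ hsig hloc.queries,
      meanEstimator_isPAC _ sig ε δ hsig hε hδ hδ1 hloc, fun hεs => ?_⟩⟩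
  have hcard := card_refineIdx_le hε hεs hδ hδ1
  have hu : 1 ≤ sig / ε := (one_le_div hε).2 hεs
  have hρ := one_le_rlog (sig / ε)
  have htotal : ((meanEstimator (medianSearch lam sig T) sig ε δ hsig).n : ℝ) =
      (medianSearch lam sig T).n + Fintype.card (RefineIdx sig ε δ) := by
    simp only [meanEstimator]
    push_cast
    rfl
  rw [htotal, ← div_pow]
  have hmono : rlog (1 / δ) ≤ rlog (rlog (sig / ε) / δ) :=
    rlog_mono (by positivity) (by gcongr)
  have hΛ := one_le_rlog (rlog (sig / ε) / δ)
  have h1 : 1 ≤ (sig / ε) ^ 2 * rlog (sig / ε) ^ 3 :=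
    one_le_mul_of_one_le_of_one_le (one_le_pow₀ hu) (one_le_pow₀ hρ)
  have h2 : rlog (1 / δ) ≤ (sig / ε) ^ 2 * rlog (sig / ε) ^ 3 * rlog (rlog (sig / ε) / δ) :=
    hmono.trans (le_mul_of_one_le_left (by linarith) h1)
  have h3 : (sig / ε) ^ 2 * rlog (sig / ε) ^ 3 * rlog (rlog (sig / ε) / δ) ≤
      2 * ((sig / ε) ^ 2 * rlog (1 / δ) * rlog (sig / ε) ^ 4) := by
    calc _ ≤ (sig / ε) ^ 2 * rlog (sig / ε) ^ 3 * (2 * (rlog (sig / ε) * rlog (1 / δ))) := by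
          gcongr
          exact rlog_div_le hρ hδ
      _ = _ := by ring
  constructor <;> linarith
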